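/- Let $d\ge 1$ and let $\nu$ be a compactly supported Borel probability measure on $\mathbb{R}^d$. **Definitions.** For $n\in\mathbb{N}_0$ let $\mathcal{D}_n$ be the partition of $\mathbb{R}^d$ into the half-open dyadic cubes $\prod_{i=1}^d (k_i2^{-n},(k_i+1)2^{-n}]$, $k\in\mathbb{Z}^d$, and let $\mathcal{D}=\bigcup_{n\ge 0}\mathcal{D}_n$. Let $\Lambda$ denote Lebesgue measure on $\mathbb{R}^d$. *Quantization dimensions.* For $r>0$ and $n\ge1$ let $$\mathfrak{e}_{n,r}(\nu)=\inf_{f}\Big(\int |x-f(x)|^r\,d\nu(x)\Big)^{1/r},$$ the infimum over all Borel measurable $f:\mathbb{R}^d\to\mathbb{R}^d$ with at most $n$ values, and let $\mathfrak{e}_{n,0}(\nu)=\inf_{A}\exp\int\log d(x,A)\,d\nu(x)$, the infimum over all $A\subset\mathbb{R}^d$ with $1\le \operatorname{card}A\le n$, where $\log 0=-\infty$ and $\exp(-\infty)=0$. For $r\ge0$ put $$\overline{D}_r(\nu)=\limsup_{n\to\infty}\frac{\log n}{-\log \mathfrak{e}_{n,r}(\nu)},\qquad \underline{D}_r(\nu)=\liminf_{n\to\infty}\frac{\log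 n}{-\log \mathfrak{e}_{n,r}(\nu)},$$ where the quotient is read as $0$ if $\mathfrak{e}_{n,r}(\nu)=0$. If both agree, the common value is denoted by $D_r(\nu)$. *$L^q$-spectrum and Rényi dimension.* For $q\ge0$ let $$\beta_\nu(q)=\limsup_{n\to\infty}\frac{\log\sum_{C\in\mathcal{D}_n,\ \nu(C)>0}\nu(C)^q}{\log 2^n},$$ and for $r>0$ let $q_r=\inf\{q>0:\beta_\nu(q)<rq\}$. For $q\ge 0$ let $\overline{\mathfrak{R}}_\nu(q)=\beta_\nu(q)/(1-q)$ if $q\ne1$, and $\overline{\mathfrak{R}}_\nu(1)=\limsup_{n}\big(\sum_{C\in\mathcal{D}_n}\nu(C)\log\nu(C)\big)/\log 2^{-n}$, where $0\log 0=0$. *Partition entropy.* A $\nu$-partition is a finite collection $P$ of the form $P=\{Q\in\tilde P:\nu(Q)>0\}$, where $\tilde P$ is a partition of $\mathbb{R}^d$ by cubes from $\mathcal{D}$ (if $\operatorname{supp}\nu\subset(0,1]^d$, one may equivalently take partitions of $(0,1]^d$ by cubes from $\mathcal{D}$). For $r>0$ and $x>0$ let $$\mathcal{M}_{\nu,r}(x)=\min\big\{\operatorname{card}P: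 P \text{ a } \nu\text{-partition},\ \max_{Q\in P}\nu(Q)\Lambda(Q)^{r/d}<1/x\big\},\qquad \underline{h}_r=\liminf_{x\to\infty}\frac{\log\mathcal{M}_{\nu,r}(x)}{\log x}.$$ *Coarse multifractal dimension.* For $r>0$, $\alpha>0$ let $\mathcal{N}_{\alpha,r}(n)=\operatorname{card}\{Q\in\mathcal{D}_n:\nu(Q)\Lambda(Q)^{r/d}\ge2^{-\alpha n}\}$ and $$\underline{F}_r=\sup_{\alpha>0}\frac1\alpha\liminf_{n\to\infty}\frac{\log^+\mathcal{N}_{\alpha,r}(n)}{\log 2^n}.$$ **Theorem.** (i) If $\sup_{x\in(0,1)}\beta_\nu(x)>0$, then for every $r>0$ the numbers $\underline{F}_r$, $\underline{h}_r$ and $q_r$ are smaller than $1$, and $$\frac{r\underline{F}_r}{1-\underline{F}_r}\le\underline{D}_r(\nu)\le\frac{r\underline{h}_r}{1-\underline{h}_r}\le\overline{D}_r(\nu)=\overline{\mathfrak{R}}_\nu(q_r)=\frac{rq_r}{1-q_r}.$$ (ii) If instead $\beta_\nu(x)=0$ for all $x>0$, then for every $r\ge0$ the quantization dimension $D_r(\nu)$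 exists and equals $0$. -/

import Mathlib

open MeasureTheory Filter Topology
open scoped ENNReal

noncomputable section

namespace Quantization

/-- The `d`-dimensional Euclidean space, with the Euclidean norm. -/
abbrev E (d : ℕ) : Type := EuclideanSpace ℝ (Fin d)

variable {d : ℕ}

/-! ### Dyadic cubes -/

/-- The half-open dyadic cube `∏ i, (k i * 2⁻ⁿ, (k i + 1) * 2⁻ⁿ]`. -/
def dyadicCube (n : ℕ) (k : Fin d → ℤ) : Set (E d) :=
  {x | ∀ i, (k i : ℝ) / 2 ^ n < x i ∧ x i ≤ ((k i : ℝ) + 1) / 2 ^ n}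

/-- The dyadic cubes of side length `2⁻ⁿ`; they partition the space. -/
def dyadicCubes (d n : ℕ) : Set (Set (E d)) :=
  Set.range (dyadicCube (d := d) n)

/-- All dyadic cubes of side length at most one. -/
def allDyadicCubes (d : ℕ) : Set (Set (E d)) :=
  ⋃ n : ℕ, dyadicCubes d n

/-! ### Quantization error and quantization dimensions -/

/-- The `n`-quantizers: Borel measurable self-maps of the space with at most `n` values. -/
def quantizers (d n : ℕ) : Set (E d → E d) :=
  {f | Measurable f ∧ (Set.range f).encard ≤ n}

/-- The extended integral `∫ log d(x, A) dν(x)`, as the integral of the positive part minus the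
integral of the negative part, where `log 0 = -∞`. The value `-∞` is allowed. -/
def logDistIntegral (ν : Measure (E d)) (A : Set (E d)) : EReal :=
  ((∫⁻ x, (ENNReal.log (Metric.infEDist x A)).toENNReal ∂ν : ℝ≥0∞) : EReal)
    - ((∫⁻ x, (-ENNReal.log (Metric.infEDist x A)).toENNReal ∂ν : ℝ≥0∞) : EReal)

/-- The `n`-th quantization error of `ν` of order `r ≥ 0`. For `r > 0` it is the infimum of the
`L^r`-quasinorms of `x - f x` over all `n`-quantizers `f`; for `r = 0` it is the geometric mean
error, the infimum of `exp ∫ log d(x, A) dν(x)` over sets `A` with `1 ≤ card A ≤ n`. -/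
def quantizationError (ν : Measure (E d)) (n : ℕ) (r : ℝ) : ℝ≥0∞ :=
  if r = 0 then
    ⨅ A ∈ {A : Set (E d) | 1 ≤ A.encard ∧ A.encard ≤ n}, EReal.exp (logDistIntegral ν A)
  else
    ⨅ f ∈ quantizers d n, (∫⁻ x, ‖x - f x‖ₑ ^ r ∂ν) ^ (1 / r)

/-- The quotient `log n / (- log e)` where `e` is the `n`-th quantization error of order `r`.
If `e = 0`, then `- log e = ∞` and the quotient is `0` (for `n ≥ 1`). -/
def quantizationRate (ν : Measure (E d)) (r : ℝ) (n : ℕ) : EReal :=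
  ((Real.log n : ℝ) : EReal) / (-ENNReal.log (quantizationError ν n r))

/-- The upper quantization dimension of `ν` of order `r`. -/
def upperQuantizationDim (ν : Measure (E d)) (r : ℝ) : EReal :=
  limsup (fun n : ℕ => quantizationRate ν r n) atTop

/-- The lower quantization dimension of `ν` of order `r`. -/
def lowerQuantizationDim (ν : Measure (E d)) (r : ℝ) : EReal :=
  liminf (fun n : ℕ => quantizationRate ν r n) atTop

/-! ### The `L^q`-spectrum and the Rényi dimension -/

/-- `log (∑ ν(C)^q) / log (2^n)`, the sum over the dyadic cubes `C` of side length `2⁻ⁿ`. The sum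
is restricted to the cubes with `ν(C) ≠ 0`, which is the convention `0 ^ 0 = 0`. If `ν` is
compactly supported, there are only finitely many of them. -/
def lqSpectrumAt (ν : Measure (E d)) (n : ℕ) (q : ℝ) : ℝ :=
  Real.log (∑' C : {C : Set (E d) // C ∈ dyadicCubes d n ∧ ν C ≠ 0}, ν.real C.1 ^ q)
    / Real.log (2 ^ n)

/-- The `L^q`-spectrum of `ν`, for `q ≥ 0`. -/
def lqSpectrum (ν : Measure (E d)) (q : ℝ) : EReal :=
  limsup (fun n : ℕ => (lqSpectrumAt ν n q : EReal)) atTop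

/-- The critical point `q_r = inf {q > 0 : β(q) < r q}`, where `β` is the `L^q`-spectrum. -/
def criticalPoint (ν : Measure (E d)) (r : ℝ) : ℝ :=
  sInf {q : ℝ | 0 < q ∧ lqSpectrum ν q < ((r * q : ℝ) : EReal)}

/-- The upper generalized Rényi dimension of `ν`, for `q ≥ 0`. -/
def renyiDim (ν : Measure (E d)) (q : ℝ) : EReal :=
  if q = 1 then
    limsup (fun n : ℕ =>
      (((∑' C : {C : Set (E d) // C ∈ dyadicCubes d n ∧ ν C ≠ 0},
          ν.real C.1 * Real.log (ν.real C.1)) / Real.log ((2 ^ n)⁻¹) : ℝ) : EReal)) atTop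
  else
    lqSpectrum ν q / ((1 - q : ℝ) : EReal)

/-! ### Partition entropy -/

/-- The set function `Q ↦ ν(Q) Λ(Q)^(r/d)`, where `Λ` is Lebesgue measure. -/
def weight (ν : Measure (E d)) (r : ℝ) (Q : Set (E d)) : ℝ :=
  ν.real Q * volume.real Q ^ (r / d)

/-- The `ν`-partitions: finite collections `P` which consist of the cubes of positive
`ν`-measure of some partition of the space by dyadic cubes of side length at most one.
If `ν` is concentrated on `(0,1]^d`, one gets the same collections from the partitions of `(0,1]^d`
by such cubes, since `(0,1]^d` is itself a dyadic cube of side length one. -/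
def nuPartitions (ν : Measure (E d)) : Set (Set (Set (E d))) :=
  {P | P.Finite ∧ ∃ P' ⊆ allDyadicCubes d,
    (∀ x : E d, ∃! Q : Set (E d), Q ∈ P' ∧ x ∈ Q) ∧ P = {Q ∈ P' | 0 < ν Q}}

/-- The smallest cardinality of a `ν`-partition all of whose members `Q` satisfy
`ν(Q) Λ(Q)^(r/d) < 1/x`. If `ν` is a compactly supported probability measure and `r, x > 0`, then
such `ν`-partitions exist: take the cubes of side length `2⁻ⁿ` for a large `n`. -/
def minPartitionCard (ν : Measure (E d)) (r x : ℝ) : ℕ :=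
  sInf {m : ℕ | ∃ P ∈ nuPartitions ν, (∀ Q ∈ P, weight ν r Q < 1 / x) ∧ P.ncard = m}

/-- The lower partition entropy. -/
def lowerPartitionEntropy (ν : Measure (E d)) (r : ℝ) : EReal :=
  liminf (fun x : ℝ =>
    ((Real.log (minPartitionCard ν r x) / Real.log x : ℝ) : EReal)) atTop

/-! ### Coarse multifractal dimension -/

/-- The number of dyadic cubes `Q` of side length `2⁻ⁿ` with `ν(Q) Λ(Q)^(r/d) ≥ 2^(-α n)`. -/
def coarseCount (ν : Measure (E d)) (r α : ℝ) (n : ℕ) : ℕ :=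
  {Q ∈ dyadicCubes d n | (2 : ℝ) ^ (-α * n) ≤ weight ν r Q}.ncard

/-- The lower growth exponent of `coarseCount`, with `log⁺` in place of `log`. -/
def lowerCoarseExponent (ν : Measure (E d)) (r α : ℝ) : EReal :=
  liminf (fun n : ℕ =>
    ((Real.posLog (coarseCount ν r α n) / Real.log (2 ^ n) : ℝ) : EReal)) atTop

/-- The lower optimized coarse multifractal dimension. -/
def lowerCoarseDim (ν : Measure (E d)) (r : ℝ) : EReal :=
  ⨆ α ∈ Set.Ioi (0 : ℝ), lowerCoarseExponent ν r α / (α : EReal)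

end Quantization

end

/-! The map f ↦ r f / (1 - f) increases on [0, 1) and has inverse y ↦ y / (y + r). Each bound of a
dimension by y is a comparison of the error with n^(-1/y), proved with a strict gap between
exponents that absorbs all constants.

Upper bounds. A ν-partition into M cubes of weight below 1/x, with one point chosen per cube, gives
a quantizer with ∫ |y - f y|^r at most a constant times M/x (`exists_quantizer_of_nuPartition`). If
M ≤ x^s and n ≈ x^s, this is of order n^(1 - 1/s), which corresponds to the dimension r s / (1 - s).
Along a sequence of x this bounds the lower dimension through the partition entropy. For all n, stop
at the first dyadic cube of weight below 1/x (`exists_nuPartition`): a stopped cube has level 0 or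
is a child of a cube of weight at least 1/x. Markov's inequality for weight^s, summed over all
levels, leaves at most T x^s such heavy cubes as soon as β(s) < r s. This also gives h ≤ q_r.

Lower bounds. At level n, m points have at most 3^d m cubes next to them; every other cube is at
distance at least 2⁻ⁿ from the points and contributes at least its weight to the error integral
(`le_lintegral_of_quantizer`). Hence 2^(α f n) cubes of weight at least 2^(-α n) yield the dimension
r f / (1 - f): the lower one if this holds for all large n, the upper one if it holds infinitely
often. The latter occurs for some α whenever 0 < f < q_r, because β(f) > r f and finitely many
weight classes cannot all be small (`exists_frequently_le_card_heavyIndices`).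

Convexity makes β continuous at q_r > 0, so β(q_r) = r q_r, which is the Rényi identity. In case
(ii) every s > 0 is admissible, so every y > 0 bounds the dimension; order 0 reduces to order 1 by a
tangent of the logarithm. -/

namespace Quantization

variable {d : ℕ}

/-! ### Dyadic cubes and their indices -/

/-- The index of the dyadic cube of side length `2⁻ⁿ` which contains `x`. -/
noncomputable def cubeIndex (n : ℕ) (x : E d) : Fin d → ℤ := fun i => ⌈x i * 2 ^ n⌉ - 1

/-- The cubes of level n are the fibres of `cubeIndex n`, so disjointness and nesting become
statements about integers. Cubes closed on the right call for the ceiling. -/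
lemma mem_dyadicCube_iff {n : ℕ} {k : Fin d → ℤ} {x : E d} :
    x ∈ dyadicCube n k ↔ cubeIndex n x = k := by
  have h2 : (0 : ℝ) < 2 ^ n := by positivity
  simp only [dyadicCube, Set.mem_ofPred_eq, funext_iff, cubeIndex]
  refine forall_congr' fun i => ?_
  rw [div_lt_iff₀ h2, le_div_iff₀ h2, sub_eq_iff_eq_add, Int.ceil_eq_iff]
  push_cast
  simp

lemma mem_dyadicCube_cubeIndex (n : ℕ) (x : E d) : x ∈ dyadicCube n (cubeIndex n x) :=
  mem_dyadicCube_iff.2 rfl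

lemma dyadicCube_nonempty (n : ℕ) (k : Fin d → ℤ) : (dyadicCube n k).Nonempty := by
  have h2 : (0 : ℝ) < 2 ^ n := by positivity
  refine ⟨WithLp.toLp 2 fun i => ((k i : ℝ) + 1) / 2 ^ n, fun i => ⟨?_, le_rfl⟩⟩
  exact div_lt_div_of_pos_right (by simp) h2

lemma dyadicCube_injective (n : ℕ) : Function.Injective (dyadicCube (d := d) n) := by
  intro k l h
  obtain ⟨x, hx⟩ := dyadicCube_nonempty n k
  exact (mem_dyadicCube_iff.1 hx).symm.trans (mem_dyadicCube_iff.1 (h ▸ hx))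

lemma disjoint_dyadicCube {n : ℕ} {k l : Fin d → ℤ} (h : k ≠ l) :
    Disjoint (dyadicCube n k) (dyadicCube n l) :=
  Set.disjoint_left.2 fun _ hk hl =>
    h ((mem_dyadicCube_iff.1 hk).symm.trans (mem_dyadicCube_iff.1 hl))

lemma dyadicCube_eq_preimage (n : ℕ) (k : Fin d → ℤ) :
    dyadicCube n k = (WithLp.ofLp (p := 2) (V := Fin d → ℝ)) ⁻¹'
      Set.univ.pi fun i => Set.Ioc ((k i : ℝ) / 2 ^ n) (((k i : ℝ) + 1) / 2 ^ n) := by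
  ext x
  simp [dyadicCube]

lemma measurableSet_dyadicCube (n : ℕ) (k : Fin d → ℤ) : MeasurableSet (dyadicCube n k) := by
  rw [dyadicCube_eq_preimage]
  exact (PiLp.volume_preserving_ofLp (Fin d)).measurable
    (MeasurableSet.univ_pi fun i => measurableSet_Ioc)

lemma volume_real_dyadicCube (n : ℕ) (k : Fin d → ℤ) :
    volume.real (dyadicCube n k) = ((2 ^ n)⁻¹) ^ d := by
  rw [measureReal_def, dyadicCube_eq_preimage,
    (PiLp.volume_preserving_ofLp (Fin d)).measure_preimage
      (MeasurableSet.univ_pi fun i => measurableSet_Ioc).nullMeasurableSet, Real.volume_pi_Ioc,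
    ENNReal.toReal_prod]
  have : ∀ i : Fin d, ((k i : ℝ) + 1) / 2 ^ n - (k i : ℝ) / 2 ^ n = (2 ^ n)⁻¹ := fun i => by ring
  simp [this]

/-- The exponent r/d turns volume into the r-th power of the side length. For d = 0 the quotient r/d
would be 0 and the formula would fail. -/
lemma weight_dyadicCube (hd : 0 < d) (ν : Measure (E d)) (r : ℝ) (n : ℕ) (k : Fin d → ℤ) :
    weight ν r (dyadicCube n k) = ν.real (dyadicCube n k) * 2 ^ (-r * n) := by
  have hd' : (d : ℝ) ≠ 0 := by positivity
  rw [weight, volume_real_dyadicCube, ← Real.rpow_natCast _ d, ← Real.rpow_mul (by positivity),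
    mul_div_cancel₀ _ hd', Real.inv_rpow (by positivity), ← Real.rpow_natCast,
    ← Real.rpow_mul (by positivity), ← Real.rpow_neg (by positivity)]
  ring_nf

lemma weight_nonneg (ν : Measure (E d)) (r : ℝ) (Q : Set (E d)) : 0 ≤ weight ν r Q := by
  unfold weight; positivity

/-- The index of the cube of side length `2⁻ⁿ` is determined by that of the cube of half the side
length. -/
lemma cubeIndex_succ (n : ℕ) (x : E d) (i : Fin d) :
    cubeIndex n x i = cubeIndex (n + 1) x i / 2 := by
  have h1 := Int.ceil_lt_add_one (x i * 2 ^ n)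
  have h2 := Int.le_ceil (x i * 2 ^ n)
  have h3 := Int.ceil_lt_add_one (x i * 2 ^ (n + 1))
  have h4 := Int.le_ceil (x i * 2 ^ (n + 1))
  rw [pow_succ, ← mul_assoc] at h3 h4
  simp only [cubeIndex]
  rw [pow_succ, ← mul_assoc]
  set t := x i * 2 ^ n
  have h5 : ⌈t * 2⌉ ≤ 2 * ⌈t⌉ := by
    rw [Int.ceil_le]; push_cast; linarith
  have h6 : 2 * ⌈t⌉ < ⌈t * 2⌉ + 2 := by
    have : ((2 * ⌈t⌉ : ℤ) : ℝ) < ((⌈t * 2⌉ + 2 : ℤ) : ℝ) := by push_cast; linarith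
    exact_mod_cast this
  omega

lemma cubeIndex_eq_of_le {m n : ℕ} (hmn : m ≤ n) {x y : E d}
    (h : cubeIndex n x = cubeIndex n y) : cubeIndex m x = cubeIndex m y := by
  induction n, hmn using Nat.le_induction with
  | base => exact h
  | succ n _ ih => exact ih (funext fun i => by rw [cubeIndex_succ, cubeIndex_succ n y, h])

lemma countable_allDyadicCubes : (allDyadicCubes d).Countable :=
  Set.countable_iUnion fun _ => Set.countable_range _

lemma measurableSet_of_mem_allDyadicCubes {Q : Set (E d)} (h : Q ∈ allDyadicCubes d) :
    MeasurableSet Q := by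
  obtain ⟨n, k, rfl⟩ := Set.mem_iUnion.1 h
  exact measurableSet_dyadicCube n k

lemma abs_sub_le_of_mem_dyadicCube {n : ℕ} {k : Fin d → ℤ} {x y : E d}
    (hx : x ∈ dyadicCube n k) (hy : y ∈ dyadicCube n k) (i : Fin d) :
    |x i - y i| ≤ (2 ^ n)⁻¹ := by
  have e : ((k i : ℝ) + 1) / 2 ^ n = (k i : ℝ) / 2 ^ n + (2 ^ n)⁻¹ := by ring
  have h1 := hx i
  have h2 := hy i
  rw [e] at h1 h2
  rw [abs_le]
  constructor <;> linarith [h1.1, h1.2, h2.1, h2.2]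

lemma norm_sub_le_of_mem_dyadicCube {n : ℕ} {k : Fin d → ℤ} {x y : E d}
    (hx : x ∈ dyadicCube n k) (hy : y ∈ dyadicCube n k) :
    ‖x - y‖ ≤ √d * (2 ^ n)⁻¹ := by
  rw [EuclideanSpace.norm_eq]
  calc √(∑ i, ‖(x - y) i‖ ^ 2) ≤ √(∑ _i : Fin d, ((2 ^ n)⁻¹ : ℝ) ^ 2) := by
        refine Real.sqrt_le_sqrt (Finset.sum_le_sum fun i _ => ?_)
        exact pow_le_pow_left₀ (norm_nonneg _) (abs_sub_le_of_mem_dyadicCube hx hy i) 2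
    _ = √d * (2 ^ n)⁻¹ := by
        rw [Finset.sum_const, Finset.card_univ, Fintype.card_fin, nsmul_eq_mul,
          Real.sqrt_mul (by positivity), Real.sqrt_sq (by positivity)]

/-- Two points whose cubes are not neighbours are at distance at least the side length. -/
lemma le_norm_sub_of_cubeIndex {n : ℕ} {x y : E d} {i : Fin d}
    (h : 1 < |cubeIndex n x i - cubeIndex n y i|) : ((2 : ℝ) ^ n)⁻¹ ≤ ‖x - y‖ := by
  have h0 : (0 : ℝ) < 2 ^ n := by positivity
  have hxy : |x i - y i| ≤ ‖x - y‖ := by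
    simpa using PiLp.norm_apply_le (x - y) i
  refine le_trans ?_ hxy
  have hx := Int.ceil_lt_add_one (x i * 2 ^ n)
  have hx' := Int.le_ceil (x i * 2 ^ n)
  have hy := Int.ceil_lt_add_one (y i * 2 ^ n)
  have hy' := Int.le_ceil (y i * 2 ^ n)
  simp only [cubeIndex] at h
  have e : |x i - y i| * 2 ^ n = |x i * 2 ^ n - y i * 2 ^ n| := by
    rw [← sub_mul, abs_mul, abs_of_pos h0]
  rw [inv_eq_one_div, div_le_iff₀ h0, e, le_abs]
  rcases lt_abs.1 h with h | h
  · left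
    have : (2 : ℝ) ≤ (⌈x i * 2 ^ n⌉ : ℝ) - ⌈y i * 2 ^ n⌉ := by
      have : (2 : ℤ) ≤ ⌈x i * 2 ^ n⌉ - ⌈y i * 2 ^ n⌉ := by omega
      exact_mod_cast this
    linarith
  · right
    have : (2 : ℝ) ≤ (⌈y i * 2 ^ n⌉ : ℝ) - ⌈x i * 2 ^ n⌉ := by
      have : (2 : ℤ) ≤ ⌈y i * 2 ^ n⌉ - ⌈x i * 2 ^ n⌉ := by omega
      exact_mod_cast this
    linarith

/-! ### The cubes of positive measure -/

open Classical in
/-- The indices of the dyadic cubes of side length `2⁻ⁿ` with positive measure, if they are finite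
in number. -/
noncomputable def activeIndices (ν : Measure (E d)) (n : ℕ) : Finset (Fin d → ℤ) :=
  if h : {k | ν (dyadicCube n k) ≠ 0}.Finite then h.toFinset else ∅

/-- A compactly supported measure charges at most a constant times `2 ^ (n * d)` cubes of side
length `2⁻ⁿ`. -/
lemma exists_activeIndices_bound {ν : Measure (E d)}
    (hν : ∃ K : Set (E d), IsCompact K ∧ ν Kᶜ = 0) :
    ∃ c : ℝ, 1 ≤ c ∧ ∀ n, {k | ν (dyadicCube n k) ≠ 0}.Finite ∧
      ((activeIndices ν n).card : ℝ) ≤ c * 2 ^ (n * d) := by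
  obtain ⟨K, hK, hKν⟩ := hν
  obtain ⟨R, hR⟩ := hK.isBounded.exists_norm_le
  obtain ⟨m, hm⟩ := exists_nat_ge R
  refine ⟨(2 * m + 2 : ℝ) ^ d, one_le_pow₀ (by linarith [m.cast_nonneg (α := ℝ)]), fun n => ?_⟩
  -- The support lies in [-m, m]^d, which leaves at most 2 m 2^n + 2 indices per coordinate.
  have hsub : {k | ν (dyadicCube (d := d) n k) ≠ 0} ⊆
      (Fintype.piFinset fun _ : Fin d =>
        Finset.Icc (-(m * 2 ^ n : ℤ) - 1) (m * 2 ^ n : ℤ) : Finset (Fin d → ℤ)) := by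
    intro k hk
    have : (dyadicCube n k ∩ K).Nonempty := by
      by_contra hne
      refine hk (measure_mono_null ?_ hKν)
      intro x hx hxK
      exact hne ⟨x, hx, hxK⟩
    obtain ⟨x, hx, hxK⟩ := this
    rw [Finset.mem_coe, Fintype.mem_piFinset]
    intro i
    have h2 : (0 : ℝ) < 2 ^ n := by positivity
    have h3 : |x i| ≤ m := by
      have := PiLp.norm_apply_le x i
      rw [Real.norm_eq_abs] at this
      linarith [hR x hxK]
    have h4 := abs_le.1 h3
    have h5 := hx i
    rw [div_lt_iff₀ h2, le_div_iff₀ h2] at h5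
    have h6 : x i * 2 ^ n ≤ m * 2 ^ n := mul_le_mul_of_nonneg_right h4.2 h2.le
    have h7 : -(m : ℝ) * 2 ^ n ≤ x i * 2 ^ n := mul_le_mul_of_nonneg_right h4.1 h2.le
    rw [Finset.mem_Icc]
    constructor
    · have : ((-(m * 2 ^ n : ℤ) - 1 : ℤ) : ℝ) ≤ k i := by push_cast; linarith [h5.2]
      exact_mod_cast this
    · have : (k i : ℝ) ≤ ((m * 2 ^ n : ℤ) : ℝ) := by push_cast; linarith [h5.1]
      exact_mod_cast this
  have hfin := (Finset.finite_toSet _).subset hsub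
  refine ⟨hfin, ?_⟩
  have hcard : (activeIndices ν n).card ≤ (2 * m * 2 ^ n + 2) ^ d := by
    rw [activeIndices, dif_pos hfin]
    refine (Finset.card_le_card (t := Fintype.piFinset fun _ : Fin d =>
        Finset.Icc (-(m * 2 ^ n : ℤ) - 1) (m * 2 ^ n : ℤ)) ?_).trans ?_
    · intro k hk
      exact hsub (by simpa using hk)
    · rw [Fintype.card_piFinset, Finset.prod_const, Int.card_Icc, Finset.card_univ,
        Fintype.card_fin]
      refine Nat.pow_le_pow_left ?_ d
      have : ((m * 2 ^ n : ℕ) : ℤ) = m * 2 ^ n := by push_cast; ring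
      rw [← this, mul_assoc]
      omega
  calc ((activeIndices ν n).card : ℝ) ≤ (2 * m * 2 ^ n + 2 : ℝ) ^ d := by exact_mod_cast hcard
    _ ≤ ((2 * m + 2) * 2 ^ n) ^ d := by
        have : (1 : ℝ) ≤ 2 ^ n := one_le_pow₀ (by norm_num)
        gcongr
        linarith
    _ = (2 * m + 2 : ℝ) ^ d * 2 ^ (n * d) := by rw [mul_pow, pow_mul]

lemma mem_activeIndices {ν : Measure (E d)}
    (hν : ∃ K : Set (E d), IsCompact K ∧ ν Kᶜ = 0) {n : ℕ} {k : Fin d → ℤ} :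
    k ∈ activeIndices ν n ↔ ν (dyadicCube n k) ≠ 0 := by
  obtain ⟨_, _, h⟩ := exists_activeIndices_bound hν
  rw [activeIndices, dif_pos (h n).1]
  simp

lemma measureReal_pos_of_mem {ν : Measure (E d)} [IsProbabilityMeasure ν]
    (hν : ∃ K : Set (E d), IsCompact K ∧ ν Kᶜ = 0) {n : ℕ} {k : Fin d → ℤ}
    (hk : k ∈ activeIndices ν n) : 0 < ν.real (dyadicCube n k) :=
  ENNReal.toReal_pos ((mem_activeIndices hν).1 hk) (measure_ne_top _ _)

lemma sum_activeIndices {ν : Measure (E d)} [IsProbabilityMeasure ν]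
    (hν : ∃ K : Set (E d), IsCompact K ∧ ν Kᶜ = 0) (n : ℕ) :
    ∑ k ∈ activeIndices ν n, ν.real (dyadicCube n k) = 1 := by
  rw [← measureReal_biUnion_finset (fun k _ l _ h => disjoint_dyadicCube h)
    fun k _ => measurableSet_dyadicCube n k]
  have h0 : ν (⋃ k ∈ activeIndices ν n, dyadicCube n k)ᶜ = 0 := by
    refine measure_mono_null (t := ⋃ k ∈ {k | k ∉ activeIndices ν n}, dyadicCube n k) ?_ ?_
    · intro x hx
      simp only [Set.mem_compl_iff, Set.mem_iUnion, not_exists] at hx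
      simp only [Set.mem_iUnion]
      exact ⟨cubeIndex n x, fun h => hx _ h (mem_dyadicCube_cubeIndex n x),
        mem_dyadicCube_cubeIndex n x⟩
    · rw [measure_biUnion_null_iff (Set.to_countable _)]
      intro k hk
      by_contra h
      exact hk ((mem_activeIndices hν).2 h)
  have hm : MeasurableSet (⋃ k ∈ activeIndices ν n, dyadicCube n k) :=
    Finset.measurableSet_biUnion _ fun k _ => measurableSet_dyadicCube n k
  rw [measureReal_def, (prob_compl_eq_zero_iff hm).1 h0, ENNReal.toReal_one]

/-- The partition function `∑ ν(C)^q` over the dyadic cubes of side length `2⁻ⁿ`. -/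
noncomputable def partitionSum (ν : Measure (E d)) (n : ℕ) (q : ℝ) : ℝ :=
  ∑ k ∈ activeIndices ν n, ν.real (dyadicCube n k) ^ q

lemma lqSpectrumAt_eq {ν : Measure (E d)} (hν : ∃ K : Set (E d), IsCompact K ∧ ν Kᶜ = 0)
    (n : ℕ) (q : ℝ) :
    lqSpectrumAt ν n q = Real.log (partitionSum ν n q) / (n * Real.log 2) := by
  have e : (∑' C : {C : Set (E d) // C ∈ dyadicCubes d n ∧ ν C ≠ 0}, ν.real C.1 ^ q) =
      partitionSum ν n q := by
    let φ : {k // k ∈ activeIndices ν n} ≃ {C : Set (E d) // C ∈ dyadicCubes d n ∧ ν C ≠ 0} :=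
      Equiv.ofBijective (fun k => ⟨dyadicCube n k.1, ⟨k.1, rfl⟩, (mem_activeIndices hν).1 k.2⟩) <| by
        constructor
        · intro k l h
          exact Subtype.ext (dyadicCube_injective n (congrArg Subtype.val h))
        · rintro ⟨_, ⟨k, rfl⟩, hk⟩
          exact ⟨⟨k, (mem_activeIndices hν).2 hk⟩, rfl⟩
    rw [← φ.tsum_eq, partitionSum]
    exact Finset.tsum_subtype (activeIndices ν n) fun k => ν.real (dyadicCube n k) ^ q
  rw [lqSpectrumAt, e, Real.log_pow]

/-! ### The `L^q`-spectrum on the unit interval -/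

section Spectrum

variable {ν : Measure (E d)} [IsProbabilityMeasure ν]
  (hν : ∃ K : Set (E d), IsCompact K ∧ ν Kᶜ = 0)

include hν

lemma partitionSum_one (n : ℕ) : partitionSum ν n 1 = 1 := by
  simpa [partitionSum] using sum_activeIndices hν n

lemma partitionSum_anti (n : ℕ) {p q : ℝ} (hpq : p ≤ q) :
    partitionSum ν n q ≤ partitionSum ν n p :=
  Finset.sum_le_sum fun _ hk =>
    Real.rpow_le_rpow_of_exponent_ge (measureReal_pos_of_mem hν hk) measureReal_le_one hpq

lemma one_le_partitionSum (n : ℕ) {q : ℝ} (hq : q ≤ 1) : 1 ≤ partitionSum ν n q :=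
  (partitionSum_one hν n).symm.le.trans (partitionSum_anti hν n hq)

omit [IsProbabilityMeasure ν] hν in
lemma partitionSum_zero (n : ℕ) : partitionSum ν n 0 = (activeIndices ν n).card := by
  simp [partitionSum]

/-- Hölder's inequality, that is, log-convexity in the exponent: weighted AM-GM for the terms
normalised by A and B, then summation. -/
lemma partitionSum_holder (n : ℕ) {a b s t : ℝ} (ha : a ≤ 1) (hb : b ≤ 1)
    (hs : 0 ≤ s) (ht : 0 ≤ t) (hst : s + t = 1) :
    partitionSum ν n (s * a + t * b) ≤ partitionSum ν n a ^ s * partitionSum ν n b ^ t := by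
  have hA : 0 < partitionSum ν n a := one_pos.trans_le (one_le_partitionSum hν n ha)
  have hB : 0 < partitionSum ν n b := one_pos.trans_le (one_le_partitionSum hν n hb)
  set A := partitionSum ν n a with hAdef
  set B := partitionSum ν n b with hBdef
  have key : ∀ k ∈ activeIndices ν n, ν.real (dyadicCube n k) ^ (s * a + t * b) ≤
      A ^ s * B ^ t * (s * (ν.real (dyadicCube n k) ^ a / A) +
        t * (ν.real (dyadicCube n k) ^ b / B)) := by
    intro k hk
    have hp := measureReal_pos_of_mem hν hk
    set p := ν.real (dyadicCube n k)
    have h := Real.geom_mean_le_arith_mean2_weighted hs ht (p₁ := p ^ a / A) (p₂ := p ^ b / B)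
      (by positivity) (by positivity) hst
    refine le_trans (le_of_eq ?_) (mul_le_mul_of_nonneg_left h (by positivity))
    rw [Real.div_rpow (by positivity) hA.le, Real.div_rpow (by positivity) hB.le,
      ← Real.rpow_mul hp.le, ← Real.rpow_mul hp.le, Real.rpow_add hp, mul_comm a, mul_comm b]
    field_simp
  calc partitionSum ν n (s * a + t * b) ≤ _ := Finset.sum_le_sum key
    _ = A ^ s * B ^ t * (s * (A / A) + t * (B / B)) := by
      rw [← Finset.mul_sum, Finset.sum_add_distrib, ← Finset.mul_sum, ← Finset.mul_sum,
        ← Finset.sum_div, ← Finset.sum_div]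
      rfl
    _ = A ^ s * B ^ t := by
      rw [div_self hA.ne', div_self hB.ne', mul_one, mul_one, hst, mul_one]

lemma lqSpectrumAt_nonneg (n : ℕ) {q : ℝ} (hq : q ≤ 1) : 0 ≤ lqSpectrumAt ν n q := by
  rw [lqSpectrumAt_eq hν]
  exact div_nonneg (Real.log_nonneg (one_le_partitionSum hν n hq)) (by positivity)

lemma lqSpectrumAt_anti (n : ℕ) {p q : ℝ} (hpq : p ≤ q) (hq : q ≤ 1) :
    lqSpectrumAt ν n q ≤ lqSpectrumAt ν n p := by
  rw [lqSpectrumAt_eq hν, lqSpectrumAt_eq hν]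
  have := one_le_partitionSum hν n hq
  exact div_le_div_of_nonneg_right
    (Real.log_le_log (by linarith) (partitionSum_anti hν n hpq)) (by positivity)

lemma lqSpectrumAt_convex (n : ℕ) {a b s t : ℝ} (ha : a ≤ 1) (hb : b ≤ 1)
    (hs : 0 ≤ s) (ht : 0 ≤ t) (hst : s + t = 1) :
    lqSpectrumAt ν n (s * a + t * b) ≤ s * lqSpectrumAt ν n a + t * lqSpectrumAt ν n b := by
  have hA : 0 < partitionSum ν n a := one_pos.trans_le (one_le_partitionSum hν n ha)
  have hB : 0 < partitionSum ν n b := one_pos.trans_le (one_le_partitionSum hν n hb)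
  have hab : s * a + t * b ≤ 1 := by nlinarith
  have hC : 0 < partitionSum ν n (s * a + t * b) :=
    one_pos.trans_le (one_le_partitionSum hν n hab)
  rw [lqSpectrumAt_eq hν, lqSpectrumAt_eq hν, lqSpectrumAt_eq hν, ← mul_div_assoc,
    ← mul_div_assoc, ← add_div, ← Real.log_rpow hA, ← Real.log_rpow hB,
    ← Real.log_mul (by positivity) (by positivity)]
  exact div_le_div_of_nonneg_right
    (Real.log_le_log hC (partitionSum_holder hν n ha hb hs ht hst)) (by positivity)

/-- Makes the spectrum finite on [0, 1], so that real convexity theory applies to its `toReal`. -/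
lemma exists_lqSpectrumAt_le :
    ∃ D : ℝ, ∀ n : ℕ, ∀ q : ℝ, 0 ≤ q → q ≤ 1 → lqSpectrumAt ν n q ≤ D := by
  obtain ⟨c, hc, h⟩ := exists_activeIndices_bound hν
  have hlc := Real.log_nonneg hc
  have h2 : 0 < Real.log 2 := Real.log_pos (by norm_num)
  refine ⟨Real.log c / Real.log 2 + d, fun n q hq hq1 => ?_⟩
  refine (lqSpectrumAt_anti hν n hq hq1).trans ?_
  rcases Nat.eq_zero_or_pos n with rfl | hn
  · rw [lqSpectrumAt_eq hν]
    simp only [CharP.cast_eq_zero, zero_mul, div_zero]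
    positivity
  have hn1 : (1 : ℝ) ≤ n := by exact_mod_cast hn
  rw [lqSpectrumAt_eq hν, div_le_iff₀ (by positivity), partitionSum_zero]
  have hpos : (0 : ℝ) < (activeIndices ν n).card := by
    rw [← partitionSum_zero]
    exact one_pos.trans_le (one_le_partitionSum hν n zero_le_one)
  calc Real.log (activeIndices ν n).card ≤ Real.log (c * 2 ^ (n * d)) :=
        Real.log_le_log hpos (h n).2
    _ = Real.log c + n * d * Real.log 2 := by
        rw [Real.log_mul (by positivity) (by positivity), Real.log_pow]; push_cast; ring
    _ ≤ n * Real.log c + n * d * Real.log 2 := by nlinarith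
    _ = (Real.log c / Real.log 2 + d) * (n * Real.log 2) := by field_simp

lemma coe_toReal_lqSpectrum {q : ℝ} (hq : 0 ≤ q) (hq1 : q ≤ 1) :
    (((lqSpectrum ν q).toReal : ℝ) : EReal) = lqSpectrum ν q := by
  obtain ⟨D, hD⟩ := exists_lqSpectrumAt_le hν
  have h1 : lqSpectrum ν q ≤ (D : EReal) :=
    limsup_le_of_le (by isBoundedDefault)
      (Eventually.of_forall fun n => EReal.coe_le_coe_iff.2 (hD n q hq hq1))
  have h0 : (0 : EReal) ≤ lqSpectrum ν q :=
    le_limsup_of_le (by isBoundedDefault) fun b hb => by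
      obtain ⟨n, hn⟩ := hb.exists
      exact le_trans (EReal.coe_nonneg.2 (lqSpectrumAt_nonneg hν n hq1)) hn
  refine EReal.coe_toReal (h1.trans_lt (EReal.coe_lt_top D)).ne ?_
  exact ((EReal.bot_lt_coe 0).trans_le h0).ne'

lemma lqSpectrum_nonneg {q : ℝ} (hq1 : q ≤ 1) : 0 ≤ lqSpectrum ν q :=
  le_limsup_of_le (by isBoundedDefault) fun b hb => by
    obtain ⟨n, hn⟩ := hb.exists
    exact le_trans (EReal.coe_nonneg.2 (lqSpectrumAt_nonneg hν n hq1)) hn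

lemma lqSpectrum_anti {p q : ℝ} (hpq : p ≤ q) (hq : q ≤ 1) :
    lqSpectrum ν q ≤ lqSpectrum ν p :=
  limsup_le_limsup (Eventually.of_forall fun n =>
    EReal.coe_le_coe_iff.2 (lqSpectrumAt_anti hν n hpq hq))

lemma lqSpectrum_one : lqSpectrum ν 1 = 0 := by
  have : ∀ n, lqSpectrumAt ν n 1 = 0 := fun n => by
    rw [lqSpectrumAt_eq hν, partitionSum_one hν]; simp
  simp [lqSpectrum, this]

/-- Each level is convex by Hölder, and the limsup, being subadditive, keeps convexity. -/
lemma convexOn_lqSpectrum :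
    ConvexOn ℝ (Set.Icc 0 1) fun q => (lqSpectrum ν q).toReal := by
  refine ⟨convex_Icc 0 1, fun a ha b hb s t hs ht hst => ?_⟩
  have hab := convex_Icc (0 : ℝ) 1 ha hb hs ht hst
  simp only [smul_eq_mul] at hab ⊢
  refine le_of_forall_pos_le_add fun ε hε => ?_
  rw [← EReal.coe_le_coe_iff, coe_toReal_lqSpectrum hν hab.1 hab.2]
  have hev : ∀ {q : ℝ}, q ∈ Set.Icc (0 : ℝ) 1 →
      ∀ᶠ n in atTop, lqSpectrumAt ν n q < (lqSpectrum ν q).toReal + ε := by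
    intro q hq
    have : lqSpectrum ν q < (((lqSpectrum ν q).toReal + ε : ℝ) : EReal) := by
      conv_lhs => rw [← coe_toReal_lqSpectrum hν hq.1 hq.2]
      exact EReal.coe_lt_coe_iff.2 (by linarith)
    filter_upwards [eventually_lt_of_limsup_lt this] with n hn
    exact EReal.coe_lt_coe_iff.1 hn
  refine limsup_le_of_le (by isBoundedDefault) ?_
  filter_upwards [hev ha, hev hb] with n h1 h2
  rw [EReal.coe_le_coe_iff]
  refine (lqSpectrumAt_convex hν n ha.2 hb.2 hs ht hst).trans ?_
  calc _ ≤ s * ((lqSpectrum ν a).toReal + ε) + t * ((lqSpectrum ν b).toReal + ε) := by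
        gcongr
    _ = _ := by
        have : s * ε + t * ε = ε := by rw [← add_mul, hst, one_mul]
        linarith

/-- Near `1` the `L^q`-spectrum lies below any line of positive slope through the origin. -/
lemma exists_lqSpectrum_lt {r : ℝ} (hr : 0 < r) :
    ∃ s : ℝ, 0 < s ∧ s < 1 ∧ lqSpectrum ν s < ((r * s : ℝ) : EReal) := by
  have hB : 0 ≤ (lqSpectrum ν 0).toReal := by
    rw [← EReal.coe_nonneg, coe_toReal_lqSpectrum hν le_rfl zero_le_one]
    exact lqSpectrum_nonneg hν zero_le_one
  set B := (lqSpectrum ν 0).toReal with hBdef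
  -- At 1 - τ the chord from (0, B) to (1, 0) has height τ B, which is below r (1 - τ) when τ (B +
  -- r) < r; τ = r / (B + 2 r) satisfies this.
  refine ⟨1 - r / (B + 2 * r), ?_, ?_, ?_⟩
  · rw [sub_pos, div_lt_one (by positivity)]; linarith
  · have : 0 < r / (B + 2 * r) := by positivity
    linarith
  have h0 : 0 ≤ r / (B + 2 * r) := by positivity
  have h1 : r / (B + 2 * r) ≤ 1 := by rw [div_le_one (by positivity)]; linarith
  have hc := (convexOn_lqSpectrum hν).2 (Set.left_mem_Icc.2 zero_le_one)
    (Set.right_mem_Icc.2 zero_le_one) h0 (sub_nonneg.2 h1) (by ring)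
  simp only [smul_eq_mul, mul_zero, zero_add, mul_one, lqSpectrum_one hν, EReal.toReal_zero,
    add_zero] at hc
  rw [← coe_toReal_lqSpectrum hν (sub_nonneg.2 h1) (by linarith), EReal.coe_lt_coe_iff]
  refine hc.trans_lt ?_
  rw [← hBdef]
  have : r / (B + 2 * r) * (B + 2 * r) = r := by field_simp
  nlinarith

omit [IsProbabilityMeasure ν] hν in
lemma criticalPoint_le_of_lt {r s : ℝ} (hs : 0 < s)
    (h : lqSpectrum ν s < ((r * s : ℝ) : EReal)) : criticalPoint ν r ≤ s :=
  csInf_le ⟨0, fun _ hq => hq.1.le⟩ ⟨hs, h⟩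

lemma criticalPoint_lt_one {r : ℝ} (hr : 0 < r) : criticalPoint ν r < 1 := by
  obtain ⟨s, hs, hs1, h⟩ := exists_lqSpectrum_lt hν hr
  exact (criticalPoint_le_of_lt hs h).trans_lt hs1

/-- β is nonincreasing and q ↦ r q increasing, so within (0, 1] the condition β(q) < r q persists to
the right. -/
lemma lqSpectrum_lt_of_criticalPoint_lt {r s : ℝ} (hr : 0 < r) (hs : criticalPoint ν r < s)
    (hs1 : s ≤ 1) : lqSpectrum ν s < ((r * s : ℝ) : EReal) := by
  obtain ⟨t, ht, -, h⟩ := exists_lqSpectrum_lt hν hr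
  have hne : {q : ℝ | 0 < q ∧ lqSpectrum ν q < ((r * q : ℝ) : EReal)}.Nonempty := ⟨t, ht, h⟩
  obtain ⟨q, ⟨-, hq⟩, hqs⟩ := exists_lt_of_csInf_lt hne hs
  exact (lqSpectrum_anti hν hqs.le hs1).trans_lt
    (hq.trans (EReal.coe_lt_coe_iff.2 (by nlinarith)))

omit [IsProbabilityMeasure ν] hν in
lemma criticalPoint_nonneg (r : ℝ) : 0 ≤ criticalPoint ν r :=
  Real.sInf_nonneg fun _ hq => hq.1.le

lemma criticalPoint_pos (h : 0 < ⨆ x ∈ Set.Ioo (0 : ℝ) 1, lqSpectrum ν x) {r : ℝ} (hr : 0 < r) :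
    0 < criticalPoint ν r := by
  obtain ⟨x, hx⟩ := lt_iSup_iff.1 h
  obtain ⟨hx1, hx2⟩ := lt_iSup_iff.1 hx
  have hy : 0 < (lqSpectrum ν x).toReal := by
    rwa [← coe_toReal_lqSpectrum hν hx1.1.le hx1.2.le, EReal.coe_pos] at hx2
  by_contra hcon
  -- By monotonicity β(q) ≥ β(x) ≥ r q for all q up to this minimum, so the critical point cannot
  -- lie below it.
  have hmin : 0 < min x ((lqSpectrum ν x).toReal / r) := lt_min hx1.1 (by positivity)
  have h1 := lqSpectrum_lt_of_criticalPoint_lt hν hr ((not_lt.1 hcon).trans_lt hmin)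
    ((min_le_left _ _).trans hx1.2.le)
  have h2 := (lqSpectrum_anti hν (min_le_left x ((lqSpectrum ν x).toReal / r)) hx1.2.le).trans_lt h1
  have h2 : (lqSpectrum ν x).toReal < r * min x ((lqSpectrum ν x).toReal / r) := by
    rwa [← EReal.coe_lt_coe_iff, coe_toReal_lqSpectrum hν hx1.1.le hx1.2.le]
  have h3 := mul_le_mul_of_nonneg_left (min_le_right x ((lqSpectrum ν x).toReal / r)) hr.le
  rw [mul_div_cancel₀ _ hr.ne'] at h3
  linarith

/-- A positive critical point is interior to [0, 1], where a convex function is continuous; the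
limits from the right and from the left give the two inequalities. -/
lemma toReal_lqSpectrum_criticalPoint {r : ℝ} (hr : 0 < r) (h0 : 0 < criticalPoint ν r) :
    (lqSpectrum ν (criticalPoint ν r)).toReal = r * criticalPoint ν r := by
  set c := criticalPoint ν r with hc
  have h1 : c < 1 := criticalPoint_lt_one hν hr
  have hcont : ContinuousAt (fun q => (lqSpectrum ν q).toReal) c := by
    have := (convexOn_lqSpectrum hν).continuousOn_interior
    rw [interior_Icc] at this
    exact this.continuousAt (Ioo_mem_nhds h0 h1)
  have hlin : ContinuousAt (fun q : ℝ => r * q) c := by fun_prop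
  apply le_antisymm
  · refine le_of_tendsto_of_tendsto (hcont.mono_left nhdsWithin_le_nhds)
      (hlin.mono_left nhdsWithin_le_nhds) (b := 𝓝[>] c) ?_
    filter_upwards [Ioo_mem_nhdsGT h1] with q hq
    have := lqSpectrum_lt_of_criticalPoint_lt hν hr hq.1 hq.2.le
    rw [← coe_toReal_lqSpectrum hν (h0.trans hq.1).le hq.2.le, EReal.coe_lt_coe_iff] at this
    exact this.le
  · refine le_of_tendsto_of_tendsto (hlin.mono_left nhdsWithin_le_nhds)
      (hcont.mono_left nhdsWithin_le_nhds) (b := 𝓝[<] c) ?_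
    filter_upwards [Ioo_mem_nhdsLT h0] with q hq
    rw [← EReal.coe_le_coe_iff, coe_toReal_lqSpectrum hν hq.1.le (hq.2.trans h1).le]
    by_contra hcon
    exact absurd (criticalPoint_le_of_lt hq.1 (not_le.1 hcon)) (not_le.2 hq.2)

/-- Below the critical point the `L^q`-spectrum is strictly above the line of slope `r`. -/
lemma lt_lqSpectrum_of_lt_criticalPoint {r q : ℝ} (hr : 0 < r) (hq : 0 < q)
    (h : q < criticalPoint ν r) : ((r * q : ℝ) : EReal) < lqSpectrum ν q := by
  have h1 := (criticalPoint_lt_one hν hr).le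
  have h2 := toReal_lqSpectrum_criticalPoint hν hr (hq.trans h)
  have h3 := lqSpectrum_anti hν h.le h1
  rw [← coe_toReal_lqSpectrum hν (hq.trans h).le h1, h2] at h3
  exact lt_of_lt_of_le (EReal.coe_lt_coe_iff.2 (by nlinarith)) h3

lemma renyiDim_criticalPoint {r : ℝ} (hr : 0 < r) (h0 : 0 < criticalPoint ν r) :
    renyiDim ν (criticalPoint ν r) =
      ((r * criticalPoint ν r / (1 - criticalPoint ν r) : ℝ) : EReal) := by
  have h1 := criticalPoint_lt_one hν hr
  rw [renyiDim, if_neg h1.ne, ← coe_toReal_lqSpectrum hν h0.le h1.le,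
    toReal_lqSpectrum_criticalPoint hν hr h0, ← EReal.coe_div]

lemma eventually_partitionSum_lt {q c : ℝ} (hq1 : q ≤ 1) (h : lqSpectrum ν q < (c : EReal)) :
    ∀ᶠ n : ℕ in atTop, partitionSum ν n q < 2 ^ (c * n) := by
  filter_upwards [eventually_lt_of_limsup_lt h, eventually_gt_atTop 0] with n hn hn0
  have hn0' : (0 : ℝ) < n := by exact_mod_cast hn0
  have h2 : 0 < Real.log 2 := Real.log_pos (by norm_num)
  rw [EReal.coe_lt_coe_iff, lqSpectrumAt_eq hν, div_lt_iff₀ (by positivity)] at hn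
  rw [← Real.log_lt_log_iff (one_pos.trans_le (one_le_partitionSum hν n hq1)) (by positivity),
    Real.log_rpow (by norm_num)]
  linarith

lemma frequently_lt_partitionSum {q c : ℝ} (hq1 : q ≤ 1) (h : (c : EReal) < lqSpectrum ν q) :
    ∃ᶠ n : ℕ in atTop, 2 ^ (c * n) < partitionSum ν n q := by
  refine ((frequently_lt_of_lt_limsup (by isBoundedDefault) h).and_eventually
    (eventually_gt_atTop 0)).mono fun n hn => ?_
  obtain ⟨hn, hn0⟩ := hn
  have hn0' : (0 : ℝ) < n := by exact_mod_cast hn0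
  have h2 : 0 < Real.log 2 := Real.log_pos (by norm_num)
  rw [EReal.coe_lt_coe_iff, lqSpectrumAt_eq hν, lt_div_iff₀ (by positivity)] at hn
  rw [← Real.log_lt_log_iff (by positivity) (one_pos.trans_le (one_le_partitionSum hν n hq1)),
    Real.log_rpow (by norm_num)]
  linarith

end Spectrum

/-! ### Counting cubes of large weight -/

open Classical in
/-- The indices of the cubes of side length `2⁻ⁿ` of positive measure and weight at least `c`. -/
noncomputable def heavyIndices (ν : Measure (E d)) (r : ℝ) (n : ℕ) (c : ℝ) :
    Finset (Fin d → ℤ) :=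
  (activeIndices ν n).filter fun k => c ≤ weight ν r (dyadicCube n k)

section Heavy

variable {ν : Measure (E d)} [IsProbabilityMeasure ν]
  (hν : ∃ K : Set (E d), IsCompact K ∧ ν Kᶜ = 0)

include hν

omit [IsProbabilityMeasure ν] in
lemma mem_heavyIndices {r : ℝ} {n : ℕ} {c : ℝ} (hc : 0 < c) {k : Fin d → ℤ} :
    k ∈ heavyIndices ν r n c ↔ c ≤ weight ν r (dyadicCube n k) := by
  simp only [heavyIndices, Finset.mem_filter, and_iff_right_iff_imp]
  intro h
  rw [mem_activeIndices hν]
  intro h0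
  simp only [weight, measureReal_def, h0, ENNReal.toReal_zero, zero_mul] at h
  linarith

omit [IsProbabilityMeasure ν] in
lemma coarseCount_eq (r α : ℝ) (n : ℕ) :
    coarseCount ν r α n = (heavyIndices ν r n (2 ^ (-α * n))).card := by
  rw [coarseCount, ← Set.ncard_coe_finset,
    ← Set.ncard_image_of_injective _ (dyadicCube_injective n)]
  congr 1
  ext Q
  constructor
  · rintro ⟨⟨k, rfl⟩, hk⟩
    exact ⟨k, (mem_heavyIndices hν (by positivity)).2 hk, rfl⟩
  · rintro ⟨k, hk, rfl⟩
    exact ⟨⟨k, rfl⟩, (mem_heavyIndices hν (by positivity)).1 hk⟩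

omit [IsProbabilityMeasure ν] hν in
lemma sum_weight_rpow (hd : 0 < d) (r s : ℝ) (n : ℕ) :
    ∑ k ∈ activeIndices ν n, weight ν r (dyadicCube n k) ^ s =
      2 ^ (-(r * s) * n) * partitionSum ν n s := by
  rw [partitionSum, Finset.mul_sum]
  refine Finset.sum_congr rfl fun k _ => ?_
  rw [weight_dyadicCube hd, Real.mul_rpow (by positivity) (by positivity),
    ← Real.rpow_mul (by positivity), mul_comm]
  ring_nf

omit [IsProbabilityMeasure ν] hν in
-- Markov's inequality for weight^s.
lemma card_heavyIndices_mul_le (hd : 0 < d) {r s c : ℝ} (hs : 0 ≤ s) (hc : 0 < c) (n : ℕ) :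
    (heavyIndices ν r n c).card * c ^ s ≤ 2 ^ (-(r * s) * n) * partitionSum ν n s := by
  classical
  rw [← sum_weight_rpow hd, ← nsmul_eq_mul, ← Finset.sum_const]
  calc ∑ _k ∈ heavyIndices ν r n c, c ^ s
      ≤ ∑ k ∈ heavyIndices ν r n c, weight ν r (dyadicCube n k) ^ s := by
        refine Finset.sum_le_sum fun k hk => ?_
        simp only [heavyIndices, Finset.mem_filter] at hk
        exact Real.rpow_le_rpow hc.le hk.2 hs
    _ ≤ _ := by
        refine Finset.sum_le_sum_of_subset_of_nonneg ?_ fun k _ _ => ?_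
        · intro k hk
          simp only [heavyIndices, Finset.mem_filter] at hk
          exact hk.1
        · exact Real.rpow_nonneg (weight_nonneg ν r _) s

/-- For c strictly between β(s) and r s the terms are eventually dominated by the geometric sequence
2^((c - r s) n). The bound T ≥ 1 keeps later constants at least 1. -/
lemma exists_sum_partitionSum_le {r s : ℝ} (hs1 : s ≤ 1)
    (h : lqSpectrum ν s < ((r * s : ℝ) : EReal)) :
    ∃ T : ℝ, 1 ≤ T ∧ ∀ N : ℕ,
      ∑ n ∈ Finset.range N, (2 : ℝ) ^ (-(r * s) * n) * partitionSum ν n s ≤ T := by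
  obtain ⟨c, hc1, hc2⟩ := EReal.lt_iff_exists_real_btwn.1 h
  rw [EReal.coe_lt_coe_iff] at hc2
  have hnn : ∀ n : ℕ, 0 ≤ (2 : ℝ) ^ (-(r * s) * n) * partitionSum ν n s := fun n => by
    have := one_le_partitionSum hν n hs1
    positivity
  have hsum : Summable fun n : ℕ => (2 : ℝ) ^ (-(r * s) * n) * partitionSum ν n s := by
    have hg : Summable fun n : ℕ => ((2 : ℝ) ^ (c - r * s)) ^ n :=
      summable_geometric_of_lt_one (by positivity)
        (Real.rpow_lt_one_of_one_lt_of_neg (by norm_num) (by linarith))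
    refine Summable.of_norm_bounded_eventually_nat hg ?_
    filter_upwards [eventually_partitionSum_lt hν hs1 hc1] with n hn
    rw [Real.norm_of_nonneg (hnn n), ← Real.rpow_natCast, ← Real.rpow_mul (by norm_num)]
    calc (2 : ℝ) ^ (-(r * s) * n) * partitionSum ν n s
        ≤ (2 : ℝ) ^ (-(r * s) * n) * 2 ^ (c * n) := by gcongr
      _ = _ := by rw [← Real.rpow_add (by norm_num)]; ring_nf
  refine ⟨max 1 (∑' n : ℕ, (2 : ℝ) ^ (-(r * s) * n) * partitionSum ν n s), le_max_left _ _,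
    fun N => le_max_of_le_right (hsum.sum_le_tsum _ fun n _ => hnn n)⟩

lemma exists_sum_card_heavyIndices_le (hd : 0 < d) {r s : ℝ} (hs : 0 ≤ s) (hs1 : s ≤ 1)
    (h : lqSpectrum ν s < ((r * s : ℝ) : EReal)) :
    ∃ T : ℝ, 1 ≤ T ∧ ∀ x : ℝ, 0 < x → ∀ N : ℕ,
      ∑ n ∈ Finset.range N, ((heavyIndices ν r n (1 / x)).card : ℝ) ≤ T * x ^ s := by
  obtain ⟨T, hT, hN⟩ := exists_sum_partitionSum_le hν hs1 h
  refine ⟨T, hT, fun x hx N => ?_⟩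
  have h1 : (∑ n ∈ Finset.range N, ((heavyIndices ν r n (1 / x)).card : ℝ)) * (1 / x) ^ s ≤ T := by
    rw [Finset.sum_mul]
    exact (Finset.sum_le_sum fun n _ =>
      card_heavyIndices_mul_le hd hs (by positivity) n).trans (hN N)
  rwa [Real.div_rpow zero_le_one hx.le, Real.one_rpow, mul_one_div,
    div_le_iff₀ (by positivity)] at h1

/-! ### Stopping-time partitions -/

omit hν in
lemma exists_weight_lt (hd : 0 < d) {r x : ℝ} (hr : 0 < r) (hx : 0 < x) :
    ∃ L : ℕ, ∀ n, L ≤ n → ∀ k, weight ν r (dyadicCube n k) < 1 / x := by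
  obtain ⟨L, hL⟩ := exists_pow_lt_of_lt_one (show 0 < 1 / x by positivity)
    (Real.rpow_lt_one_of_one_lt_of_neg (x := 2) (by norm_num) (neg_lt_zero.2 hr))
  refine ⟨L, fun n hn k => ?_⟩
  rw [weight_dyadicCube hd]
  calc ν.real (dyadicCube n k) * 2 ^ (-r * n) ≤ 1 * 2 ^ (-r * L) := by
        gcongr ?_ * ?_
        · exact measureReal_le_one
        · refine Real.rpow_le_rpow_of_exponent_le (by norm_num) ?_
          have : (L : ℝ) ≤ n := by exact_mod_cast hn
          nlinarith
    _ < 1 / x := by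
        rwa [one_mul, Real.rpow_mul (by norm_num), Real.rpow_natCast]

/-- Stopping at the first dyadic cube of weight less than `1 / x` gives a `ν`-partition whose
cardinality is controlled by the number of cubes of weight at least `1 / x`. -/
lemma exists_nuPartition (hd : 0 < d) {r x : ℝ} (hr : 0 < r) (hx : 0 < x) :
    ∃ P ∈ nuPartitions ν, (∀ Q ∈ P, weight ν r Q < 1 / x) ∧ ∃ L : ℕ,
      P.ncard ≤ (activeIndices ν 0).card +
        2 ^ d * ∑ n ∈ Finset.range L, (heavyIndices ν r n (1 / x)).card := by
  classical
  obtain ⟨L, hL⟩ := exists_weight_lt (ν := ν) hd hr hx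
  have hex : ∀ y : E d, ∃ n, weight ν r (dyadicCube n (cubeIndex n y)) < 1 / x :=
    fun y => ⟨L, hL L le_rfl _⟩
  -- The stopping level: `Qs y` is the largest dyadic cube around y of weight below 1/x.
  let lev : E d → ℕ := fun y => Nat.find (hex y)
  let Qs : E d → Set (E d) := fun y => dyadicCube (lev y) (cubeIndex (lev y) y)
  -- A point of `Qs y` shares with y all cubes up to that level, hence also the stopping level; so
  -- the stopped cubes are disjoint.
  have hlev : ∀ y z, z ∈ Qs y → Qs z = Qs y := by
    intro y z hz
    have hyz := mem_dyadicCube_iff.1 hz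
    have hle : ∀ m ≤ lev y, cubeIndex m z = cubeIndex m y := fun m hm => cubeIndex_eq_of_le hm hyz
    have heq : lev z = lev y := by
      refine (Nat.find_eq_iff _).2 ⟨?_, fun m hm => ?_⟩
      · rw [hle _ le_rfl]; exact Nat.find_spec (hex y)
      · rw [hle _ hm.le]; exact Nat.find_min (hex y) hm
    simp only [Qs]
    rw [heq, hyz]
  -- All candidates for stopped cubes of positive measure: active cubes of level 0, and the 2^d
  -- children (indices 2 k + {0, 1}) of heavy cubes.
  let B : Finset (Set (E d)) := (activeIndices ν 0).image (dyadicCube 0) ∪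
    (Finset.range L).biUnion fun n =>
      (heavyIndices ν r n (1 / x) ×ˢ (Finset.univ : Finset (Fin d → Fin 2))).image
        fun p => dyadicCube (n + 1) fun i => 2 * p.1 i + (p.2 i : ℕ)
  have hPB : {Q ∈ Set.range Qs | 0 < ν Q} ⊆ (B : Set (Set (E d))) := by
    rintro _ ⟨⟨y, rfl⟩, hy⟩
    rw [Finset.mem_coe, Finset.mem_union]
    rcases hcase : lev y with _ | m
    · left
      simp only [Qs, hcase] at hy ⊢
      exact Finset.mem_image_of_mem _ ((mem_activeIndices hν).2 hy.ne')
    · right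
      have hm : ¬ weight ν r (dyadicCube m (cubeIndex m y)) < 1 / x :=
        Nat.find_min (hex y) (show m < lev y by omega)
      refine Finset.mem_biUnion.2 ⟨m, ?_, Finset.mem_image.2
        ⟨(cubeIndex m y, fun i => ⟨(cubeIndex (m + 1) y i % 2).toNat, by omega⟩), ?_, ?_⟩⟩
      · rw [Finset.mem_range]
        by_contra hmL
        exact hm (hL m (not_lt.1 hmL) _)
      · rw [Finset.mem_product]
        exact ⟨(mem_heavyIndices hν (by positivity)).2 (not_lt.1 hm), Finset.mem_univ _⟩
      · simp only [Qs, hcase]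
        congr 1
        ext i
        simp only [cubeIndex_succ m y i]
        omega
  refine ⟨{Q ∈ Set.range Qs | 0 < ν Q}, ⟨B.finite_toSet.subset hPB, Set.range Qs, ?_, ?_, rfl⟩,
    ?_, L, ?_⟩
  · rintro _ ⟨y, rfl⟩
    exact Set.mem_iUnion.2 ⟨lev y, cubeIndex (lev y) y, rfl⟩
  · intro y
    refine ⟨Qs y, ⟨⟨y, rfl⟩, mem_dyadicCube_cubeIndex _ y⟩, ?_⟩
    rintro _ ⟨⟨z, rfl⟩, hz⟩
    exact (hlev z y hz).symm
  · rintro _ ⟨⟨y, rfl⟩, -⟩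
    exact Nat.find_spec (hex y)
  · refine (Set.ncard_le_ncard hPB B.finite_toSet).trans ?_
    rw [Set.ncard_coe_finset]
    refine (Finset.card_union_le _ _).trans (add_le_add Finset.card_image_le ?_)
    refine Finset.card_biUnion_le.trans ?_
    rw [Finset.mul_sum]
    refine Finset.sum_le_sum fun n _ => Finset.card_image_le.trans ?_
    rw [Finset.card_product, mul_comm]
    simp

lemma exists_minPartitionCard_le (hd : 0 < d) {r s : ℝ} (hr : 0 < r) (hs : 0 ≤ s) (hs1 : s ≤ 1)
    (h : lqSpectrum ν s < ((r * s : ℝ) : EReal)) :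
    ∃ C : ℝ, 1 ≤ C ∧ ∀ x : ℝ, 1 ≤ x → (minPartitionCard ν r x : ℝ) ≤ C * x ^ s := by
  obtain ⟨T, hT, hN⟩ := exists_sum_card_heavyIndices_le hν hd hs hs1 h
  have h2d : (1 : ℝ) ≤ 2 ^ d := one_le_pow₀ (by norm_num)
  refine ⟨(activeIndices ν 0).card + 2 ^ d * T, ?_, fun x hx => ?_⟩
  · have : (0 : ℝ) ≤ (activeIndices ν 0).card := by positivity
    nlinarith
  have hx0 : 0 < x := by linarith
  obtain ⟨P, hP, hPw, L, hPL⟩ := exists_nuPartition hν hd hr hx0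
  have hle : minPartitionCard ν r x ≤ P.ncard := Nat.sInf_le ⟨P, hP, hPw, rfl⟩
  calc (minPartitionCard ν r x : ℝ) ≤ P.ncard := by exact_mod_cast hle
    _ ≤ (activeIndices ν 0).card +
        2 ^ d * ∑ n ∈ Finset.range L, ((heavyIndices ν r n (1 / x)).card : ℝ) := by
        exact_mod_cast hPL
    _ ≤ (activeIndices ν 0).card * x ^ s + 2 ^ d * (T * x ^ s) := by
        gcongr
        · exact le_mul_of_one_le_right (by positivity) (Real.one_le_rpow hx hs)
        · exact hN x hx0 L
    _ = _ := by ring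

lemma exists_nuPartition_ncard_eq (hd : 0 < d) {r x : ℝ} (hr : 0 < r) (hx : 0 < x) :
    ∃ P ∈ nuPartitions ν, (∀ Q ∈ P, weight ν r Q < 1 / x) ∧ P.ncard = minPartitionCard ν r x := by
  obtain ⟨P, hP, hPw, -⟩ := exists_nuPartition hν hd hr hx
  have hne : {m : ℕ | ∃ P ∈ nuPartitions ν, (∀ Q ∈ P, weight ν r Q < 1 / x) ∧
    P.ncard = m}.Nonempty := ⟨_, P, hP, hPw, rfl⟩
  exact Nat.sInf_mem hne

omit [IsProbabilityMeasure ν] hν in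
-- The discarded cubes are null and, being dyadic, countable in number.
lemma measure_sUnion_nuPartition {P : Set (Set (E d))} (hP : P ∈ nuPartitions ν) :
    ν (⋃₀ P)ᶜ = 0 := by
  obtain ⟨-, P', hP', hpart, rfl⟩ := hP
  have hc : (P' ∩ {Q | ν Q = 0}).Countable :=
    (countable_allDyadicCubes.mono hP').mono Set.inter_subset_left
  refine measure_mono_null (t := ⋃₀ (P' ∩ {Q | ν Q = 0})) ?_
    ((measure_sUnion_null_iff hc).2 fun Q hQ => hQ.2)
  intro y hy
  obtain ⟨Q, ⟨hQ, hyQ⟩, -⟩ := hpart y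
  refine ⟨Q, ⟨hQ, ?_⟩, hyQ⟩
  by_contra h0
  exact hy ⟨Q, ⟨hQ, pos_iff_ne_zero.2 h0⟩, hyQ⟩

lemma one_le_minPartitionCard (hd : 0 < d) {r x : ℝ} (hr : 0 < r) (hx : 0 < x) :
    1 ≤ minPartitionCard ν r x := by
  obtain ⟨P, hP, -, hcard⟩ := exists_nuPartition_ncard_eq hν hd hr hx
  rw [← hcard, Nat.one_le_iff_ne_zero, Ne, Set.ncard_eq_zero hP.1]
  rintro rfl
  simpa using measure_sUnion_nuPartition hP

end Heavy

/-! ### Bounds for the quantization error -/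

section Error

variable {ν : Measure (E d)} [IsProbabilityMeasure ν]

omit [IsProbabilityMeasure ν] in
lemma norm_sub_rpow_le {Q : Set (E d)} (hd : 0 < d) (hQ : Q ∈ allDyadicCubes d) {r : ℝ}
    (hr : 0 < r) {x y : E d} (hx : x ∈ Q) (hy : y ∈ Q) :
    ‖x - y‖ ^ r ≤ √d ^ r * volume.real Q ^ (r / d) := by
  obtain ⟨n, k, rfl⟩ := Set.mem_iUnion.1 hQ
  have hd' : (d : ℝ) ≠ 0 := by positivity
  rw [volume_real_dyadicCube, ← Real.rpow_natCast _ d, ← Real.rpow_mul (by positivity),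
    mul_div_cancel₀ _ hd', ← Real.mul_rpow (by positivity) (by positivity)]
  exact Real.rpow_le_rpow (norm_nonneg _) (norm_sub_le_of_mem_dyadicCube hx hy) hr.le

/-- A `ν`-partition into cubes of weight less than `1 / x` gives a quantizer. -/
lemma exists_quantizer_of_nuPartition (hd : 0 < d) {r x : ℝ} (hr : 0 < r) (hx : 0 < x)
    {P : Set (Set (E d))} (hP : P ∈ nuPartitions ν) (hPw : ∀ Q ∈ P, weight ν r Q < 1 / x)
    {n : ℕ} (hn : P.ncard + 1 ≤ n) :
    ∃ f ∈ quantizers d n, ∫⁻ y, ‖y - f y‖ₑ ^ r ∂ν ≤ ENNReal.ofReal (√d ^ r * (n / x)) := by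
  classical
  have hfull := measure_sUnion_nuPartition hP
  obtain ⟨hfin, P', hP', hpart, hPP'⟩ := hP
  have hsub : P ⊆ P' := by rw [hPP']; exact fun Q hQ => hQ.1
  have huniq : ∀ Q ∈ P, ∀ Q' ∈ P, ∀ y, y ∈ Q → y ∈ Q' → Q = Q' := fun Q hQ Q' hQ' y hy hy' =>
    (hpart y).unique ⟨hsub hQ, hy⟩ ⟨hsub hQ', hy'⟩
  let c : Set (E d) → E d := fun Q => if h : Q.Nonempty then h.some else 0
  have hc : ∀ Q : Set (E d), ∀ y ∈ Q, c Q ∈ Q := fun Q y hy => by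
    have h : Q.Nonempty := ⟨y, hy⟩
    simp only [c, dif_pos h, h.some_mem]
  let f : E d → E d := fun y => ∑ Q ∈ hfin.toFinset, Q.indicator (fun _ => c Q) y
  have hmeas : ∀ Q ∈ P, MeasurableSet Q := fun Q hQ =>
    measurableSet_of_mem_allDyadicCubes (hP' (hsub hQ))
  have hf : ∀ Q ∈ P, ∀ y ∈ Q, f y = c Q := by
    intro Q hQ y hy
    simp only [f]
    rw [Finset.sum_eq_single_of_mem Q (hfin.mem_toFinset.2 hQ), Set.indicator_of_mem hy]
    intro Q' hQ' hne
    exact Set.indicator_of_notMem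
      (fun hy' => hne (huniq Q' (hfin.mem_toFinset.1 hQ') Q hQ y hy' hy)) _
  refine ⟨f, ⟨?_, ?_⟩, ?_⟩
  · exact Finset.measurable_fun_sum _ fun Q hQ =>
      measurable_const.indicator (hmeas Q (hfin.mem_toFinset.1 hQ))
  · have hrange : Set.range f ⊆ insert 0 (c '' P) := by
      rintro _ ⟨y, rfl⟩
      by_cases hy : ∃ Q ∈ P, y ∈ Q
      · obtain ⟨Q, hQ, hyQ⟩ := hy
        exact Or.inr ⟨Q, hQ, (hf Q hQ y hyQ).symm⟩
      · left
        refine Finset.sum_eq_zero fun Q hQ => Set.indicator_of_notMem (fun hyQ => ?_) _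
        exact hy ⟨Q, hfin.mem_toFinset.1 hQ, hyQ⟩
    calc (Set.range f).encard ≤ (insert 0 (c '' P)).encard := Set.encard_le_encard hrange
      _ ≤ (c '' P).encard + 1 := Set.encard_insert_le _ _
      _ ≤ P.encard + 1 := by gcongr; exact Set.encard_image_le _ _
      _ = ((P.ncard + 1 : ℕ) : ℕ∞) := by rw [Nat.cast_add, hfin.cast_ncard_eq]; rfl
      _ ≤ n := by exact_mod_cast hn
  · let a : Set (E d) → ℝ≥0∞ := fun Q => ENNReal.ofReal (√d ^ r * volume.real Q ^ (r / d))
    have hae : ∀ᵐ y ∂ν, ‖y - f y‖ₑ ^ r ≤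
        ∑ Q ∈ hfin.toFinset, Q.indicator (fun _ => a Q) y := by
      have : ∀ᵐ y ∂ν, y ∈ ⋃₀ P := hfull
      filter_upwards [this] with y hy
      obtain ⟨Q, hQ, hyQ⟩ := hy
      refine le_trans ?_ (Finset.single_le_sum (fun _ _ => zero_le) (hfin.mem_toFinset.2 hQ))
      rw [Set.indicator_of_mem hyQ, hf Q hQ y hyQ, ← ofReal_norm,
        ENNReal.ofReal_rpow_of_nonneg (norm_nonneg _) hr.le]
      exact ENNReal.ofReal_le_ofReal
        (norm_sub_rpow_le hd (hP' (hsub hQ)) hr hyQ (hc Q y hyQ))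
    calc ∫⁻ y, ‖y - f y‖ₑ ^ r ∂ν
        ≤ ∫⁻ y, ∑ Q ∈ hfin.toFinset, Q.indicator (fun _ => a Q) y ∂ν := lintegral_mono_ae hae
      _ = ∑ Q ∈ hfin.toFinset, a Q * ν Q := by
        rw [lintegral_finsetSum _ fun Q hQ =>
          measurable_const.indicator (hmeas Q (hfin.mem_toFinset.1 hQ))]
        exact Finset.sum_congr rfl fun Q hQ =>
          lintegral_indicator_const (hmeas Q (hfin.mem_toFinset.1 hQ)) _
      _ ≤ ∑ _Q ∈ hfin.toFinset, ENNReal.ofReal (√d ^ r * (1 / x)) := by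
        refine Finset.sum_le_sum fun Q hQ => ?_
        rw [← ofReal_measureReal, ← ENNReal.ofReal_mul (by positivity), mul_assoc,
          mul_comm (_ ^ (r / d) : ℝ)]
        refine ENNReal.ofReal_le_ofReal (mul_le_mul_of_nonneg_left ?_ (by positivity))
        exact (hPw Q (hfin.mem_toFinset.1 hQ)).le
      _ = ENNReal.ofReal (P.ncard * (√d ^ r * (1 / x))) := by
        rw [Finset.sum_const, ← Set.ncard_eq_toFinset_card P hfin, nsmul_eq_mul,
          ENNReal.ofReal_mul (p := (P.ncard : ℝ)) (by positivity), ENNReal.ofReal_natCast]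
      _ ≤ ENNReal.ofReal (√d ^ r * (n / x)) := by
        refine ENNReal.ofReal_le_ofReal ?_
        have : (P.ncard : ℝ) ≤ n := by exact_mod_cast (by omega : P.ncard ≤ n)
        calc (P.ncard : ℝ) * (√d ^ r * (1 / x)) = √d ^ r * (P.ncard / x) := by ring
          _ ≤ _ := by gcongr

omit [IsProbabilityMeasure ν] in
lemma quantizationError_le_of_quantizer {n : ℕ} {f : E d → E d} (hf : f ∈ quantizers d n) {r B : ℝ}
    (hr : 0 < r) (hB : 0 ≤ B) (h : ∫⁻ y, ‖y - f y‖ₑ ^ r ∂ν ≤ ENNReal.ofReal B) :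
    quantizationError ν n r ≤ ENNReal.ofReal (B ^ (1 / r)) := by
  rw [quantizationError, if_neg hr.ne', ← ENNReal.ofReal_rpow_of_nonneg hB (by positivity)]
  exact (iInf₂_le f hf).trans (ENNReal.rpow_le_rpow h (by positivity))

/-- The logarithm lies below its tangents, in a form without subtraction. -/
lemma toENNReal_log_add_le {B : ℝ} (hB : 0 < B) (hB1 : B ≤ 1) (t : ℝ≥0∞) :
    (ENNReal.log t).toENNReal + ENNReal.ofReal (-Real.log B) ≤
      (-ENNReal.log t).toENNReal + t / ENNReal.ofReal B := by
  rcases eq_or_ne t 0 with rfl | h0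
  · simp
  rcases eq_or_ne t ⊤ with rfl | htop
  · simp [ENNReal.top_div]
  obtain ⟨u, hu, rfl⟩ : ∃ u : ℝ, 0 < u ∧ ENNReal.ofReal u = t :=
    ⟨t.toReal, ENNReal.toReal_pos h0 htop, ENNReal.ofReal_toReal htop⟩
  have hlog : ENNReal.log (ENNReal.ofReal u) = ((Real.log u : ℝ) : EReal) := by
    rw [ENNReal.log_ofReal_of_pos hu]
  rw [hlog, ← EReal.coe_neg, EReal.toENNReal_of_ne_top (EReal.coe_ne_top _),
    EReal.toENNReal_of_ne_top (EReal.coe_ne_top _), EReal.toReal_coe, EReal.toReal_coe,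
    ← ENNReal.ofReal_div_of_pos hB]
  have key : Real.log u - Real.log B ≤ u / B := by
    rw [← Real.log_div hu.ne' hB.ne']
    linarith [Real.log_le_sub_one_of_pos (div_pos hu hB)]
  have hdiv : 0 < u / B := by positivity
  have hL : 0 ≤ -Real.log B := neg_nonneg.2 (Real.log_nonpos hB.le hB1)
  rcases le_total 0 (Real.log u) with h | h
  · rw [ENNReal.ofReal_of_nonpos (neg_nonpos.2 h), zero_add, ← ENNReal.ofReal_add h hL]
    exact ENNReal.ofReal_le_ofReal (by linarith)
  · rw [ENNReal.ofReal_of_nonpos h, zero_add, ← ENNReal.ofReal_add (neg_nonneg.2 h) hdiv.le]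
    exact ENNReal.ofReal_le_ofReal (by linarith)

/-- Integrating log t ≤ log B + t / B over t = d(y, A), with ∫ d(y, A) ≤ B, gives ∫ log d ≤ log B +
1; the 1 becomes the factor e. -/
lemma quantizationError_zero_le_of_quantizer {n : ℕ} {f : E d → E d} (hf : f ∈ quantizers d n)
    {B : ℝ} (hB : 0 < B) (hB1 : B < 1) (h : ∫⁻ y, ‖y - f y‖ₑ ^ (1 : ℝ) ∂ν ≤ ENNReal.ofReal B) :
    quantizationError ν n 0 ≤ ENNReal.ofReal (Real.exp 1 * B) := by
  rw [quantizationError, if_pos rfl]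
  have hA : Set.range f ∈ {A : Set (E d) | 1 ≤ A.encard ∧ A.encard ≤ n} :=
    ⟨Set.one_le_encard_iff_nonempty.2 (Set.range_nonempty f), hf.2⟩
  refine (iInf₂_le _ hA).trans ?_
  set A := Set.range f
  have hdist : ∫⁻ y, Metric.infEDist y A ∂ν ≤ ENNReal.ofReal B := by
    refine (lintegral_mono fun y => ?_).trans h
    rw [ENNReal.rpow_one, ← edist_eq_enorm_sub]
    exact Metric.infEDist_le_edist_of_mem ⟨y, rfl⟩
  have hm : Measurable fun y : E d => Metric.infEDist y A := Metric.continuous_infEDist.measurable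
  have hB0 : ENNReal.ofReal B ≠ 0 := by simpa using hB
  -- All terms are moved to the side where they are nonnegative (B < 1 makes -log B positive), so an
  -- infinite negative part is allowed.
  have hint : ∫⁻ y, (ENNReal.log (Metric.infEDist y A)).toENNReal ∂ν + ENNReal.ofReal (-Real.log B)
      ≤ ∫⁻ y, (-ENNReal.log (Metric.infEDist y A)).toENNReal ∂ν + 1 := by
    calc _ = ∫⁻ y, ((ENNReal.log (Metric.infEDist y A)).toENNReal +
            ENNReal.ofReal (-Real.log B)) ∂ν := by
          rw [lintegral_add_right _ measurable_const]; simp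
      _ ≤ ∫⁻ y, ((-ENNReal.log (Metric.infEDist y A)).toENNReal +
            Metric.infEDist y A / ENNReal.ofReal B) ∂ν :=
          lintegral_mono fun y => toENNReal_log_add_le hB hB1.le _
      _ = ∫⁻ y, (-ENNReal.log (Metric.infEDist y A)).toENNReal ∂ν +
            (∫⁻ y, Metric.infEDist y A ∂ν) / ENNReal.ofReal B := by
          rw [lintegral_add_right _ (hm.div_const _)]
          simp_rw [div_eq_mul_inv]
          rw [lintegral_mul_const _ hm]
      _ ≤ _ := by
          gcongr
          exact (ENNReal.div_le_iff hB0 ENNReal.ofReal_ne_top).2 (by simpa using hdist)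
  -- The same inequality at B = 1 gives log⁺ t ≤ t.
  have hfin : ∫⁻ y, (ENNReal.log (Metric.infEDist y A)).toENNReal ∂ν ≠ ⊤ := by
    refine ne_top_of_le_ne_top ENNReal.ofReal_ne_top ((lintegral_mono fun y => ?_).trans hdist)
    have h1 := toENNReal_log_add_le one_pos le_rfl (Metric.infEDist y A)
    rw [Real.log_one, neg_zero, ENNReal.ofReal_zero, add_zero, ENNReal.ofReal_one, div_one] at h1
    rcases le_total (ENNReal.log (Metric.infEDist y A)) 0 with h | h
    · rw [EReal.toENNReal_of_nonpos h]
      exact zero_le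
    · rwa [EReal.toENNReal_of_nonpos (x := -_) (by simpa using h), zero_add] at h1
  have hL : 0 < -Real.log B := neg_pos.2 (Real.log_neg hB hB1)
  rw [logDistIntegral]
  have hexp : ENNReal.ofReal (Real.exp 1 * B) = EReal.exp ((1 + Real.log B : ℝ) : EReal) := by
    rw [EReal.exp_coe, Real.exp_add, Real.exp_log hB]
  rw [hexp, EReal.exp_le_exp_iff]
  set I := ∫⁻ y, (ENNReal.log (Metric.infEDist y A)).toENNReal ∂ν
  set J := ∫⁻ y, (-ENNReal.log (Metric.infEDist y A)).toENNReal ∂ν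
  rcases eq_or_ne J ⊤ with hJ | hJ
  · rw [hJ, EReal.coe_ennreal_top, EReal.sub_top]
    exact bot_le
  rw [← ENNReal.ofReal_toReal hfin, ← ENNReal.ofReal_toReal hJ, EReal.coe_ennreal_ofReal,
    EReal.coe_ennreal_ofReal, max_eq_left ENNReal.toReal_nonneg,
    max_eq_left ENNReal.toReal_nonneg, ← EReal.coe_sub, EReal.coe_le_coe_iff]
  have := ENNReal.toReal_mono (by finiteness) hint
  rw [ENNReal.toReal_add hfin (by finiteness), ENNReal.toReal_add hJ (by finiteness),
    ENNReal.toReal_ofReal hL.le, ENNReal.toReal_one] at this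
  linarith

/-- Many cubes of large weight force a large quantization error. -/
lemma le_lintegral_of_quantizer (hd : 0 < d)
    (hν : ∃ K : Set (E d), IsCompact K ∧ ν Kᶜ = 0) {r c : ℝ} (hr : 0 < r) (hc : 0 < c) {m n : ℕ}
    (h : 2 * 3 ^ d * m ≤ (heavyIndices ν r n c).card) {f : E d → E d} (hf : f ∈ quantizers d m) :
    ENNReal.ofReal (m * c) ≤ ∫⁻ y, ‖y - f y‖ₑ ^ r ∂ν := by
  classical
  have hfin : (Set.range f).Finite := Set.finite_of_encard_le_coe hf.2
  have hcardA : hfin.toFinset.card ≤ m := by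
    have := hf.2
    rw [hfin.encard_eq_coe_toFinset_card] at this
    exact_mod_cast this
  -- The 3^d cubes that equal or touch the cube of a. A point in any other cube is at distance at
  -- least 2⁻ⁿ from a.
  let nb : E d → Finset (Fin d → ℤ) := fun a =>
    Fintype.piFinset fun i => Finset.Icc (cubeIndex n a i - 1) (cubeIndex n a i + 1)
  have hnb : ∀ a, (nb a).card = 3 ^ d := fun a => by
    simp only [nb, Fintype.card_piFinset, Int.card_Icc]
    rw [Finset.prod_congr rfl (g := fun _ => 3) fun i _ => by omega]
    simp
  -- At most 3^d m of the at least 2 · 3^d m heavy cubes are removed, so at least m remain.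
  let good := heavyIndices ν r n c \ hfin.toFinset.biUnion nb
  have hgood : m ≤ good.card := by
    have h1 : (hfin.toFinset.biUnion nb).card ≤ m * 3 ^ d := by
      refine Finset.card_biUnion_le.trans ?_
      rw [Finset.sum_congr rfl fun a _ => hnb a, Finset.sum_const, smul_eq_mul]
      exact Nat.mul_le_mul_right _ hcardA
    have h2 := Finset.le_card_sdiff (hfin.toFinset.biUnion nb) (heavyIndices ν r n c)
    have h3 : m * 1 ≤ m * 3 ^ d := Nat.mul_le_mul_left _ (Nat.one_le_pow _ _ (by norm_num))
    have h4 : 2 * 3 ^ d * m = 2 * (m * 3 ^ d) := by ring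
    show m ≤ (heavyIndices ν r n c \ hfin.toFinset.biUnion nb).card
    omega
  -- The cubes are disjoint, so at most one summand is nonzero at y.
  have hpt : ∀ y, ∑ k ∈ good, (dyadicCube n k).indicator
      (fun _ => ENNReal.ofReal (((2 : ℝ) ^ n)⁻¹ ^ r)) y ≤ ‖y - f y‖ₑ ^ r := by
    intro y
    simp only [Set.indicator_apply, mem_dyadicCube_iff, Finset.sum_ite_eq]
    split_ifs with hy
    · have hex : ∃ i, 1 < |cubeIndex n y i - cubeIndex n (f y) i| := by
        by_contra! hcon
        refine (Finset.mem_sdiff.1 hy).2 (Finset.mem_biUnion.2 ⟨f y, by simp, ?_⟩)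
        refine Fintype.mem_piFinset.2 fun i => Finset.mem_Icc.2 ?_
        have := abs_le.1 (hcon i)
        omega
      obtain ⟨i, hi⟩ := hex
      rw [← ofReal_norm, ENNReal.ofReal_rpow_of_nonneg (norm_nonneg _) hr.le]
      exact ENNReal.ofReal_le_ofReal
        (Real.rpow_le_rpow (by positivity) (le_norm_sub_of_cubeIndex hi) hr.le)
    · exact zero_le
  calc ENNReal.ofReal (m * c) = m * ENNReal.ofReal c := by
        rw [ENNReal.ofReal_mul (by positivity), ENNReal.ofReal_natCast]
    _ ≤ good.card * ENNReal.ofReal c := by gcongr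
    _ = ∑ _k ∈ good, ENNReal.ofReal c := by rw [Finset.sum_const, nsmul_eq_mul]
    _ ≤ ∑ k ∈ good, ENNReal.ofReal (((2 : ℝ) ^ n)⁻¹ ^ r) * ν (dyadicCube n k) := by
        refine Finset.sum_le_sum fun k hk => ?_
        rw [← ofReal_measureReal, ← ENNReal.ofReal_mul (by positivity)]
        refine ENNReal.ofReal_le_ofReal ?_
        have := (mem_heavyIndices hν hc).1 (Finset.mem_sdiff.1 hk).1
        rw [weight_dyadicCube hd] at this
        rwa [Real.inv_rpow (by positivity), ← Real.rpow_natCast, ← Real.rpow_mul (by positivity),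
          ← Real.rpow_neg (by positivity), mul_comm, mul_comm (n : ℝ), ← neg_mul]
    _ = ∫⁻ y, ∑ k ∈ good, (dyadicCube n k).indicator
          (fun _ => ENNReal.ofReal (((2 : ℝ) ^ n)⁻¹ ^ r)) y ∂ν := by
        rw [lintegral_finsetSum _ fun k _ =>
          measurable_const.indicator (measurableSet_dyadicCube n k)]
        exact Finset.sum_congr rfl fun k _ =>
          (lintegral_indicator_const (measurableSet_dyadicCube n k) _).symm
    _ ≤ _ := lintegral_mono hpt

lemma le_quantizationError (hd : 0 < d)
    (hν : ∃ K : Set (E d), IsCompact K ∧ ν Kᶜ = 0) {r c : ℝ} (hr : 0 < r) (hc : 0 < c) {m n : ℕ}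
    (h : 2 * 3 ^ d * m ≤ (heavyIndices ν r n c).card) :
    ENNReal.ofReal ((m * c) ^ (1 / r)) ≤ quantizationError ν m r := by
  rw [quantizationError, if_neg hr.ne',
    ← ENNReal.ofReal_rpow_of_nonneg (by positivity) (by positivity)]
  exact le_iInf₂ fun f hf =>
    ENNReal.rpow_le_rpow (le_lintegral_of_quantizer hd hν hr hc h hf) (by positivity)

end Error

/-! ### From power bounds on the error to the quantization dimension -/

/-- The case b = ⊤ is error zero, where the quotient is 0. -/
lemma coe_div_mem_of_le {a y : ℝ} (ha : 0 < a) (hy : 0 < y) {b : EReal}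
    (h : ((a / y : ℝ) : EReal) ≤ b) : 0 ≤ (a : EReal) / b ∧ (a : EReal) / b ≤ y := by
  induction b with
  | bot => exact absurd (le_bot_iff.1 h) (EReal.coe_ne_bot _)
  | top => simpa using hy.le
  | coe b =>
    rw [EReal.coe_le_coe_iff] at h
    have hb : 0 < b := (div_pos ha hy).trans_le h
    rw [← EReal.coe_div, EReal.coe_nonneg, EReal.coe_le_coe_iff]
    refine ⟨by positivity, ?_⟩
    rw [div_le_iff₀ hb]
    rw [div_le_iff₀ hy] at h
    linarith

lemma le_coe_div_of_le {a y : ℝ} (hy : 0 < y) {b : EReal} (hb : 0 < b)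
    (h : b ≤ ((a / y : ℝ) : EReal)) : (y : EReal) ≤ (a : EReal) / b := by
  induction b with
  | bot => exact absurd hb (by simp)
  | top => exact absurd (top_le_iff.1 h) (EReal.coe_ne_top _)
  | coe b =>
    rw [EReal.coe_le_coe_iff] at h
    rw [EReal.coe_pos] at hb
    rw [← EReal.coe_div, EReal.coe_le_coe_iff, le_div_iff₀ hb]
    rw [le_div_iff₀ hy] at h
    linarith

lemma log_ofReal_natCast_rpow {n : ℕ} (hn : 0 < n) (y : ℝ) :
    ENNReal.log (ENNReal.ofReal ((n : ℝ) ^ (-(1 / y)))) = ((-(Real.log n / y) : ℝ) : EReal) := by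
  have hn' : (0 : ℝ) < n := by exact_mod_cast hn
  rw [ENNReal.log_ofReal_of_pos (by positivity), Real.log_rpow hn']
  ring_nf

lemma quantizationRate_mem_of_le {ν : Measure (E d)} {r y : ℝ} {n : ℕ} (hn : 2 ≤ n) (hy : 0 < y)
    (h : quantizationError ν n r ≤ ENNReal.ofReal ((n : ℝ) ^ (-(1 / y)))) :
    0 ≤ quantizationRate ν r n ∧ quantizationRate ν r n ≤ y := by
  have hlog : 0 < Real.log n := Real.log_pos (by exact_mod_cast hn)
  refine coe_div_mem_of_le hlog hy ?_
  have := ENNReal.log_le_log h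
  rw [log_ofReal_natCast_rpow (by omega)] at this
  rw [EReal.le_neg, ← EReal.coe_neg]
  exact this

/-- An error of at least 1 would make -log e nonpositive and ruin the inequality; hence `h1`. -/
lemma le_quantizationRate_of_le {ν : Measure (E d)} {r y : ℝ} {n : ℕ} (hn : 2 ≤ n) (hy : 0 < y)
    (h1 : quantizationError ν n r < 1)
    (h : ENNReal.ofReal ((n : ℝ) ^ (-(1 / y))) ≤ quantizationError ν n r) :
    (y : EReal) ≤ quantizationRate ν r n := by
  refine le_coe_div_of_le hy ?_ ?_
  · rw [EReal.lt_neg_comm, neg_zero]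
    exact ENNReal.log_lt_zero_iff.2 h1
  · have := ENNReal.log_le_log h
    rw [log_ofReal_natCast_rpow (by omega)] at this
    rw [EReal.neg_le, ← EReal.coe_neg]
    exact this

/-! ### Asymptotics of powers -/

/-- From n ≤ 4 x^s one gets n/x ≲ n^(1 - 1/s), and s < y / (y + r) means 1 - 1/s < -r/y; the gap
absorbs C. The factor 4 leaves room for rounding, and uniformity in x allows x to be tied to n
later. -/
lemma eventually_mul_div_rpow_le {C r s y : ℝ} (hC : 0 < C) (hr : 0 < r) (hs : 0 < s) (hy : 0 < y)
    (hsy : s < y / (y + r)) :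
    ∀ᶠ n : ℕ in atTop, ∀ x : ℝ, 0 < x → n ≤ 4 * x ^ s →
      (C * (n / x)) ^ (1 / r) ≤ (n : ℝ) ^ (-(1 / y)) := by
  have hδ : 0 < 1 / s - 1 - r / y := by
    rw [lt_div_iff₀ (by positivity)] at hsy
    have : 1 / s - 1 - r / y = (y - s * (y + r)) / (s * y) := by field_simp; ring
    rw [this]
    exact div_pos (by linarith) (by positivity)
  have hev := ((tendsto_rpow_atTop hδ).comp tendsto_natCast_atTop_atTop).eventually_ge_atTop
    (C * 4 ^ (1 / s))
  filter_upwards [hev, eventually_gt_atTop 0] with n hn hn0 x hx hnx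
  have hn' : (0 : ℝ) < n := by exact_mod_cast hn0
  simp only [Function.comp_apply] at hn
  have hx' : ((n : ℝ) / 4) ^ (1 / s) ≤ x := by
    have : (n : ℝ) / 4 ≤ x ^ s := by linarith
    calc ((n : ℝ) / 4) ^ (1 / s) ≤ (x ^ s) ^ (1 / s) := by gcongr
      _ = x := by rw [← Real.rpow_mul hx.le, mul_one_div_cancel hs.ne', Real.rpow_one]
  have hkey : C * (n / x) ≤ (n : ℝ) ^ (-(r / y)) := by
    calc C * (n / x) ≤ C * (n / ((n : ℝ) / 4) ^ (1 / s)) := by gcongr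
      _ = (C * 4 ^ (1 / s)) * (n : ℝ) ^ (1 - 1 / s) := by
        rw [Real.div_rpow hn'.le (by norm_num), Real.rpow_sub hn', Real.rpow_one]
        field_simp
      _ ≤ (n : ℝ) ^ (1 / s - 1 - r / y) * (n : ℝ) ^ (1 - 1 / s) := by gcongr
      _ = (n : ℝ) ^ (-(r / y)) := by
        rw [← Real.rpow_add hn']; ring_nf
  calc (C * (n / x)) ^ (1 / r) ≤ ((n : ℝ) ^ (-(r / y))) ^ (1 / r) := by gcongr
    _ = (n : ℝ) ^ (-(1 / y)) := by
      rw [← Real.rpow_mul hn'.le]; congr 1; field_simp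

/-- The mirror image for lower bounds, with v the reciprocal of the weight threshold: v ≲ m^(1/f)
and 1/f < 1 + r/y. -/
lemma eventually_rpow_le_mul_inv_rpow {K f r y : ℝ} (hK : 0 < K) (hr : 0 < r) (hf : 0 < f)
    (hy : 0 < y) (hfy : y / (y + r) < f) :
    ∀ᶠ m : ℕ in atTop, ∀ v : ℝ, 0 < v → v ^ f ≤ K * m →
      (m : ℝ) ^ (-(1 / y)) ≤ (m * v⁻¹) ^ (1 / r) := by
  have hδ : 0 < r / y + 1 - 1 / f := by
    rw [div_lt_iff₀ (by positivity)] at hfy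
    have : r / y + 1 - 1 / f = (f * (y + r) - y) / (f * y) := by field_simp; ring
    rw [this]
    exact div_pos (by linarith) (by positivity)
  have hev := ((tendsto_rpow_atTop hδ).comp tendsto_natCast_atTop_atTop).eventually_ge_atTop
    (K ^ (1 / f))
  filter_upwards [hev, eventually_gt_atTop 0] with m hm hm0 v hv hvm
  have hm' : (0 : ℝ) < m := by exact_mod_cast hm0
  simp only [Function.comp_apply] at hm
  have hv' : v ≤ K ^ (1 / f) * (m : ℝ) ^ (1 / f) := by
    calc v = (v ^ f) ^ (1 / f) := by
          rw [← Real.rpow_mul hv.le, mul_one_div_cancel hf.ne', Real.rpow_one]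
      _ ≤ (K * m) ^ (1 / f) := by gcongr
      _ = _ := Real.mul_rpow hK.le hm'.le
  have hv'' : v ≤ (m : ℝ) ^ (r / y + 1) := by
    calc v ≤ (m : ℝ) ^ (r / y + 1 - 1 / f) * (m : ℝ) ^ (1 / f) := hv'.trans (by gcongr)
      _ = _ := by rw [← Real.rpow_add hm']; ring_nf
  have hkey : (m : ℝ) ^ (-(r / y)) ≤ m * v⁻¹ := by
    rw [← div_eq_mul_inv, le_div_iff₀ hv]
    calc (m : ℝ) ^ (-(r / y)) * v ≤ (m : ℝ) ^ (-(r / y)) * (m : ℝ) ^ (r / y + 1) := by gcongr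
      _ = m := by rw [← Real.rpow_add hm']; simp
  calc (m : ℝ) ^ (-(1 / y)) = ((m : ℝ) ^ (-(r / y))) ^ (1 / r) := by
        rw [← Real.rpow_mul hm'.le]; congr 1; field_simp
    _ ≤ _ := by gcongr

/-! ### Upper bounds for the quantization dimensions -/

section Dim

variable {ν : Measure (E d)} [IsProbabilityMeasure ν]
  (hν : ∃ K : Set (E d), IsCompact K ∧ ν Kᶜ = 0)

include hν

/-- It yields quantizers rather than errors, with a free constant C, because order 0 reuses the
quantizers of order 1 with C = e. -/
lemma eventually_exists_quantizer (hd : 0 < d) {C r s y : ℝ} (hC : 0 < C) (hr : 0 < r)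
    (hs : 0 < s) (hy : 0 < y) (hsy : s < y / (y + r)) :
    ∀ᶠ n : ℕ in atTop, ∀ x : ℝ, 0 < x → n ≤ 4 * x ^ s → minPartitionCard ν r x + 1 ≤ n →
      ∃ f ∈ quantizers d n, ∃ B : ℝ, 0 < B ∧
        ∫⁻ y, ‖y - f y‖ₑ ^ r ∂ν ≤ ENNReal.ofReal B ∧
        (C * B) ^ (1 / r) ≤ (n : ℝ) ^ (-(1 / y)) := by
  have hd' : (0 : ℝ) < d := by exact_mod_cast hd
  filter_upwards [eventually_mul_div_rpow_le (C := C * √d ^ r) (by positivity) hr hs hy hsy]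
    with n hn x hx hnx hM
  obtain ⟨P, hP, hPw, hcard⟩ := exists_nuPartition_ncard_eq hν hd hr hx
  obtain ⟨f, hf, hint⟩ := exists_quantizer_of_nuPartition hd hr hx hP hPw (hcard ▸ hM)
  have hn0 : (0 : ℝ) < n := by exact_mod_cast (by omega : 0 < n)
  refine ⟨f, hf, _, by positivity, hint, ?_⟩
  rw [← mul_assoc]
  exact hn x hx hnx

/-- If `β(s) < r s`, then quantizers with a power bound for the error exist for all large `n`. -/
lemma eventually_exists_quantizer_of_lqSpectrum_lt (hd : 0 < d) {C r s y : ℝ} (hC : 0 < C)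
    (hr : 0 < r) (hs : 0 < s) (h : lqSpectrum ν s < ((r * s : ℝ) : EReal)) (hy : 0 < y)
    (hsy : s < y / (y + r)) :
    ∀ᶠ n : ℕ in atTop, ∃ f ∈ quantizers d n, ∃ B : ℝ, 0 < B ∧
        ∫⁻ y, ‖y - f y‖ₑ ^ r ∂ν ≤ ENNReal.ofReal B ∧
        (C * B) ^ (1 / r) ≤ (n : ℝ) ^ (-(1 / y)) := by
  -- With x = (n - 1)^(1/t) one has x^t = n - 1, and x^(t - s) absorbs the constant A, so that the
  -- partition has at most n - 1 cubes.
  obtain ⟨t, hst, hty⟩ := exists_between hsy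
  have ht : 0 < t := hs.trans hst
  have ht1 : t < 1 := hty.trans (by rw [div_lt_one (by positivity)]; linarith)
  obtain ⟨A, hA, hM⟩ := exists_minPartitionCard_le hν hd hr hs.le (hst.trans ht1).le h
  have hev1 := (tendsto_rpow_atTop (sub_pos.2 hst)).eventually_ge_atTop A
  have hx : Tendsto (fun n : ℕ => ((n : ℝ) - 1) ^ (1 / t)) atTop atTop :=
    (tendsto_rpow_atTop (by positivity)).comp
      (tendsto_atTop_add_const_right _ (-1) tendsto_natCast_atTop_atTop)
  filter_upwards [eventually_exists_quantizer hν hd hC hr ht hy hty, hx.eventually hev1,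
    hx.eventually_ge_atTop 1, eventually_ge_atTop 2] with n h1 h2 h3 h4
  have hn : (2 : ℝ) ≤ n := by exact_mod_cast h4
  have hxt : (((n : ℝ) - 1) ^ (1 / t)) ^ t = n - 1 := by
    rw [← Real.rpow_mul (by linarith), one_div_mul_cancel ht.ne', Real.rpow_one]
  set x := ((n : ℝ) - 1) ^ (1 / t)
  have hx0 : 0 < x := by linarith
  refine h1 x hx0 (by rw [hxt]; linarith) ?_
  have hle : (minPartitionCard ν r x : ℝ) ≤ n - 1 := by
    calc (minPartitionCard ν r x : ℝ) ≤ A * x ^ s := hM x h3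
      _ ≤ x ^ (t - s) * x ^ s := by gcongr
      _ = n - 1 := by rw [← Real.rpow_add hx0, sub_add_cancel, hxt]
  have : (minPartitionCard ν r x : ℝ) + 1 ≤ n := by linarith
  exact_mod_cast this

lemma eventually_quantizationError_le (hd : 0 < d) {r s y : ℝ}
    (hr : 0 < r) (hs : 0 < s) (h : lqSpectrum ν s < ((r * s : ℝ) : EReal)) (hy : 0 < y)
    (hsy : s < y / (y + r)) :
    ∀ᶠ n : ℕ in atTop, quantizationError ν n r ≤ ENNReal.ofReal ((n : ℝ) ^ (-(1 / y))) := by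
  filter_upwards [eventually_exists_quantizer_of_lqSpectrum_lt hν hd one_pos hr hs h hy hsy]
    with n ⟨f, hf, B, hB, hint, hle⟩
  rw [one_mul] at hle
  exact (quantizationError_le_of_quantizer hf hr hB.le hint).trans (ENNReal.ofReal_le_ofReal hle)

lemma eventually_quantizationError_zero_le (hd : 0 < d) {s y : ℝ}
    (hs : 0 < s) (h : lqSpectrum ν s < (s : EReal)) (hy : 0 < y)
    (hsy : s < y / (y + 1)) :
    ∀ᶠ n : ℕ in atTop, quantizationError ν n 0 ≤ ENNReal.ofReal ((n : ℝ) ^ (-(1 / y))) := by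
  filter_upwards [eventually_exists_quantizer_of_lqSpectrum_lt hν hd (Real.exp_pos 1) one_pos hs
    (by rwa [one_mul]) hy hsy, eventually_ge_atTop 1] with n ⟨f, hf, B, hB, hint, hle⟩ hn
  rw [div_one, Real.rpow_one] at hle
  have h1 : (n : ℝ) ^ (-(1 / y)) ≤ 1 :=
    Real.rpow_le_one_of_one_le_of_nonpos (by exact_mod_cast hn)
      (neg_nonpos.2 (by positivity))
  have hB1 : B < 1 := by
    have := Real.add_one_lt_exp (one_ne_zero (α := ℝ))
    nlinarith
  exact (quantizationError_zero_le_of_quantizer hf hB hB1 hint).trans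
    (ENNReal.ofReal_le_ofReal hle)

omit [IsProbabilityMeasure ν] hν in
lemma quantizationDim_mem_of_eventually {r y : ℝ} (hy : 0 < y)
    (h : ∀ᶠ n : ℕ in atTop, quantizationError ν n r ≤ ENNReal.ofReal ((n : ℝ) ^ (-(1 / y)))) :
    0 ≤ lowerQuantizationDim ν r ∧ upperQuantizationDim ν r ≤ y := by
  constructor
  · refine le_liminf_of_le (by isBoundedDefault) ?_
    filter_upwards [h, eventually_ge_atTop 2] with n hn hn2
    exact (quantizationRate_mem_of_le hn2 hy hn).1
  · refine limsup_le_of_le (by isBoundedDefault) ?_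
    filter_upwards [h, eventually_ge_atTop 2] with n hn hn2
    exact (quantizationRate_mem_of_le hn2 hy hn).2

/-- Some s < 1 always has β(s) < r s; it gives a power decay of the error. -/
lemma eventually_quantizationError_lt_one (hd : 0 < d) {r : ℝ} (hr : 0 < r) :
    (∀ᶠ n : ℕ in atTop, quantizationError ν n r < 1) ∧ 0 ≤ lowerQuantizationDim ν r := by
  obtain ⟨s, hs, hs1, h⟩ := exists_lqSpectrum_lt hν hr
  obtain ⟨t, hst, ht1⟩ := exists_between hs1
  have ht0 : 0 < 1 - t := by linarith
  -- This is the y with y / (y + r) = t.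
  have hy : 0 < r * t / (1 - t) := div_pos (mul_pos hr (hs.trans hst)) ht0
  have hsy : s < r * t / (1 - t) / (r * t / (1 - t) + r) := by
    have : r * t / (1 - t) / (r * t / (1 - t) + r) = t := by field_simp; ring
    rwa [this]
  have hev := eventually_quantizationError_le hν hd hr hs h hy hsy
  refine ⟨?_, (quantizationDim_mem_of_eventually hy hev).1⟩
  filter_upwards [hev, eventually_ge_atTop 2] with n hn hn2
  refine hn.trans_lt ?_
  rw [ENNReal.ofReal_lt_one]
  exact Real.rpow_lt_one_of_one_lt_of_neg (by exact_mod_cast hn2)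
    (neg_lt_zero.2 (by positivity))

/-- Arbitrarily large real x have a partition with fewer than x^s cubes; n = ⌈x^s⌉ + 1 tends to
infinity with x, so good quantizers occur for arbitrarily large n. -/
lemma lowerQuantizationDim_le_of_lowerPartitionEntropy_lt (hd : 0 < d) {r s y : ℝ} (hr : 0 < r)
    (hs : 0 < s) (h : lowerPartitionEntropy ν r < (s : EReal)) (hy : 0 < y)
    (hsy : s < y / (y + r)) : lowerQuantizationDim ν r ≤ y := by
  have hfreq := frequently_lt_of_liminf_lt (by isBoundedDefault) h
  have hn : Tendsto (fun x : ℝ => ⌈x ^ s⌉₊ + 1) atTop atTop :=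
    (tendsto_add_atTop_nat 1).comp (tendsto_nat_ceil_atTop.comp (tendsto_rpow_atTop hs))
  refine liminf_le_of_frequently_le (hn.frequently
    (p := fun n => quantizationRate ν r n ≤ y) ?_) (by isBoundedDefault)
  refine (hfreq.and_eventually ((hn.eventually
    (eventually_exists_quantizer hν hd one_pos hr hs hy hsy)).and
      (eventually_gt_atTop 1))).mono fun x hx => ?_
  obtain ⟨hx1, hx2, hx3⟩ := hx
  have hx0 : 0 < x := by linarith
  have hxs : 1 ≤ x ^ s := Real.one_le_rpow hx3.le hs.le
  have hM1 : (1 : ℝ) ≤ minPartitionCard ν r x := by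
    exact_mod_cast one_le_minPartitionCard hν hd hr hx0
  have hM : (minPartitionCard ν r x : ℝ) < x ^ s := by
    rw [EReal.coe_lt_coe_iff, div_lt_iff₀ (Real.log_pos hx3), ← Real.log_rpow hx0] at hx1
    exact (Real.log_lt_log_iff (by linarith) (by positivity)).1 hx1
  have hceil := Nat.ceil_lt_add_one (zero_le_one.trans hxs)
  have hceil' := Nat.le_ceil (x ^ s)
  obtain ⟨f, hf, B, hB, hint, hle⟩ := hx2 x hx0 (by push_cast; linarith) (by
    have : (minPartitionCard ν r x : ℝ) ≤ ⌈x ^ s⌉₊ := by linarith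
    exact Nat.succ_le_succ (by exact_mod_cast this))
  rw [one_mul] at hle
  have hn2 : 2 ≤ ⌈x ^ s⌉₊ + 1 := by
    have : 0 < ⌈x ^ s⌉₊ := Nat.ceil_pos.2 (by linarith)
    omega
  exact (quantizationRate_mem_of_le hn2 hy
    ((quantizationError_le_of_quantizer hf hr hB.le hint).trans (ENNReal.ofReal_le_ofReal hle))).2

lemma lowerPartitionEntropy_mem (hd : 0 < d) {r s : ℝ} (hr : 0 < r) (hs : 0 < s) (hs1 : s ≤ 1)
    (h : lqSpectrum ν s < ((r * s : ℝ) : EReal)) :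
    0 ≤ lowerPartitionEntropy ν r ∧ lowerPartitionEntropy ν r ≤ s := by
  constructor
  · refine le_liminf_of_le (by isBoundedDefault) ?_
    filter_upwards [eventually_gt_atTop 1] with x hx
    rw [EReal.coe_nonneg]
    exact div_nonneg (Real.log_natCast_nonneg _) (Real.log_pos hx).le
  · obtain ⟨C, hC, hM⟩ := exists_minPartitionCard_le hν hd hr hs.le hs1 h
    have hlim : Tendsto (fun x : ℝ => ((Real.log C / Real.log x + s : ℝ) : EReal)) atTop
        (𝓝 ((0 + s : ℝ) : EReal)) :=
      (continuous_coe_real_ereal.tendsto _).comp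
        ((Real.tendsto_log_atTop.const_div_atTop _).add_const s)
    rw [zero_add] at hlim
    rw [← hlim.liminf_eq]
    refine liminf_le_liminf ?_
    filter_upwards [eventually_gt_atTop 1] with x hx
    have hx0 : 0 < x := by linarith
    have hM1 : (1 : ℝ) ≤ minPartitionCard ν r x := by
      exact_mod_cast one_le_minPartitionCard hν hd hr hx0
    have hlog := Real.log_pos hx
    rw [EReal.coe_le_coe_iff, div_le_iff₀ hlog, add_mul, div_mul_cancel₀ _ hlog.ne',
      ← Real.log_rpow hx0, ← Real.log_mul (by positivity) (by positivity)]
    exact Real.log_le_log (by linarith) (hM x hx.le)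

/-! ### Lower bounds for the quantization dimensions -/

/-- A single level is bounded by the count T x^s over all levels, taken at x = 2^(α n). -/
lemma lowerCoarseDim_mem (hd : 0 < d) {r s : ℝ} (hs : 0 < s) (hs1 : s ≤ 1)
    (h : lqSpectrum ν s < ((r * s : ℝ) : EReal)) :
    0 ≤ lowerCoarseDim ν r ∧ lowerCoarseDim ν r ≤ s := by
  constructor
  · refine le_trans ?_ (le_iSup₂ (f := fun α (_ : α ∈ Set.Ioi (0 : ℝ)) =>
      lowerCoarseExponent ν r α / (α : EReal)) 1 (Set.mem_Ioi.2 one_pos))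
    refine EReal.div_nonneg (le_liminf_of_le (by isBoundedDefault)
      (Eventually.of_forall fun n => ?_)) (by simp)
    rw [EReal.coe_nonneg]
    exact div_nonneg Real.posLog_nonneg (Real.log_nonneg (one_le_pow₀ (by norm_num)))
  · obtain ⟨T, hT, hN⟩ := exists_sum_card_heavyIndices_le hν hd hs.le hs1 h
    refine iSup₂_le fun α hα => ?_
    have hα0 : (0 : ℝ) < α := hα
    rw [EReal.div_le_iff_le_mul (by exact_mod_cast hα0) (EReal.coe_ne_top _), ← EReal.coe_mul]
    have hlog2 : 0 < Real.log 2 := Real.log_pos (by norm_num)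
    have hlim : Tendsto (fun n : ℕ => ((Real.log T / (n * Real.log 2) + s * α : ℝ) : EReal)) atTop
        (𝓝 ((0 + s * α : ℝ) : EReal)) :=
      (continuous_coe_real_ereal.tendsto _).comp
        (((tendsto_natCast_atTop_atTop.atTop_mul_const hlog2).const_div_atTop _).add_const _)
    rw [zero_add] at hlim
    rw [mul_comm α, ← hlim.liminf_eq]
    refine liminf_le_liminf ?_
    filter_upwards [eventually_gt_atTop 0] with n hn
    have hn0 : (0 : ℝ) < n := by exact_mod_cast hn
    have hcard : (coarseCount ν r α n : ℝ) ≤ T * 2 ^ (s * α * n) := by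
      have h1 := hN (2 ^ (α * n)) (by positivity) (n + 1)
      have h2 : (1 : ℝ) / 2 ^ (α * n) = 2 ^ (-α * n) := by
        rw [neg_mul, Real.rpow_neg (by norm_num), one_div]
      rw [h2, ← Real.rpow_mul (by norm_num)] at h1
      rw [coarseCount_eq hν]
      refine le_trans ?_ (h1.trans (le_of_eq (by ring_nf)))
      exact Finset.single_le_sum (f := fun m : ℕ => ((heavyIndices ν r m (2 ^ (-α * n))).card : ℝ))
        (fun _ _ => by positivity) (Finset.self_mem_range_succ n)
    have hpos : 0 < n * Real.log 2 := by positivity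
    rw [EReal.coe_le_coe_iff, Real.log_pow, div_le_iff₀ hpos, add_mul,
      div_mul_cancel₀ _ hpos.ne']
    have h3 : (1 : ℝ) ≤ T * 2 ^ (s * α * n) :=
      one_le_mul_of_one_le_of_one_le hT (Real.one_le_rpow (by norm_num) (by positivity))
    calc Real.posLog (coarseCount ν r α n) ≤ Real.posLog (T * 2 ^ (s * α * n)) :=
          Real.posLog_le_posLog (by positivity) hcard
      _ = Real.log T + s * α * n * Real.log 2 := by
          rw [Real.posLog_eq_log (by rwa [abs_of_nonneg (by positivity)]),
            Real.log_mul (by positivity) (by positivity), Real.log_rpow (by norm_num)]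
      _ = _ := by ring

lemma eventually_le_quantizationError (hd : 0 < d) {K r f y α : ℝ} (hK : 0 < K) (hr : 0 < r)
    (hf : 0 < f) (hy : 0 < y) (hfy : y / (y + r) < f) :
    ∀ᶠ m : ℕ in atTop, ∀ n : ℕ, 2 * 3 ^ d * (m : ℝ) ≤ 2 ^ (α * f * n) →
      (2 : ℝ) ^ (α * f * n) ≤ (heavyIndices ν r n (2 ^ (-α * n))).card →
      2 ^ (α * f * n) ≤ K * m →
      ENNReal.ofReal ((m : ℝ) ^ (-(1 / y))) ≤ quantizationError ν m r := by
  filter_upwards [eventually_rpow_le_mul_inv_rpow hK hr hf hy hfy] with m hm n h1 h2 h3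
  have h4 : 2 * 3 ^ d * m ≤ (heavyIndices ν r n (2 ^ (-α * n))).card := by
    exact_mod_cast h1.trans h2
  refine le_trans (ENNReal.ofReal_le_ofReal ?_)
    (le_quantizationError hd hν hr (by positivity) h4)
  have e : (2 : ℝ) ^ (-α * n) = (2 ^ (α * n))⁻¹ := by rw [neg_mul, Real.rpow_neg (by norm_num)]
  rw [e]
  refine hm _ (by positivity) ?_
  rw [← Real.rpow_mul (by norm_num)]
  exact le_trans (le_of_eq (by ring_nf)) h3

/-- Heavy cubes abound at every large level, so each large m can be matched with a suitable level.
-/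
lemma le_lowerQuantizationDim (hd : 0 < d) {r y : ℝ} (hr : 0 < r) (hy : 0 < y)
    (h : ((y / (y + r) : ℝ) : EReal) < lowerCoarseDim ν r) :
    (y : EReal) ≤ lowerQuantizationDim ν r := by
  obtain ⟨α, hα⟩ := lt_iSup_iff.1 h
  obtain ⟨hα0, hα⟩ := lt_iSup_iff.1 hα
  replace hα0 : (0 : ℝ) < α := hα0
  obtain ⟨f, hfy, hfα⟩ := EReal.lt_iff_exists_real_btwn.1 hα
  rw [EReal.coe_lt_coe_iff] at hfy
  have hf : 0 < f := lt_trans (by positivity) hfy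
  rw [EReal.lt_div_iff (by exact_mod_cast hα0) (EReal.coe_ne_top _), ← EReal.coe_mul] at hfα
  have hev := eventually_lt_of_lt_liminf hfα
  have hlog2 : 0 < Real.log 2 := Real.log_pos (by norm_num)
  obtain ⟨n₀, hn₀⟩ := eventually_atTop.1 (hev.and (eventually_gt_atTop 0))
  set a : ℝ := 2 ^ (α * f) with ha
  have ha1 : 1 < a := Real.one_lt_rpow (by norm_num) (by positivity)
  have hpow : ∀ n : ℕ, (2 : ℝ) ^ (α * f * n) = a ^ n := fun n => by
    rw [Real.rpow_mul (by norm_num), Real.rpow_natCast]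
  have hheavy : ∀ n, n₀ ≤ n →
      (2 : ℝ) ^ (α * f * n) ≤ (heavyIndices ν r n (2 ^ (-α * n))).card := by
    intro n hn
    obtain ⟨h1, h2⟩ := hn₀ n hn
    have hn0 : (0 : ℝ) < n := by exact_mod_cast h2
    rw [EReal.coe_lt_coe_iff, Real.log_pow, lt_div_iff₀ (by positivity), coarseCount_eq hν] at h1
    have h3 : 0 < f * α * (n * Real.log 2) := by positivity
    set N := (heavyIndices ν r n (2 ^ (-α * n))).card
    have hN : Real.posLog N = Real.log N := by
      rw [Real.posLog, max_eq_right]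
      exact Real.log_natCast_nonneg N
    rw [hN] at h1
    have hN0 : (0 : ℝ) < N := by
      rcases Nat.eq_zero_or_pos N with h0 | h0
      · rw [h0, Nat.cast_zero, Real.log_zero] at h1; linarith
      · exact_mod_cast h0
    rw [← Real.log_le_log_iff (by positivity) hN0, Real.log_rpow (by norm_num)]
    linarith
  refine le_liminf_of_le (by isBoundedDefault) ?_
  filter_upwards [eventually_le_quantizationError hν hd (K := 2 * 3 ^ d * a) (α := α)
    (by positivity) hr hf hy hfy, (eventually_quantizationError_lt_one hν hd hr).1,
    eventually_ge_atTop 2, tendsto_natCast_atTop_atTop.eventually_ge_atTop (a ^ n₀)]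
    with m h1 h2 h3 h4
  have hm : (2 : ℝ) ≤ m := by exact_mod_cast h3
  have h3d : (1 : ℝ) ≤ 3 ^ d := one_le_pow₀ (by norm_num)
  have hmm : (m : ℝ) ≤ 2 * 3 ^ d * m := by nlinarith
  -- Level n + 1 is the first at which a^n exceeds 2 · 3^d m; the overshoot is at most the factor a,
  -- whence K = 2 · 3^d a.
  obtain ⟨n, hn1, hn2⟩ := exists_nat_pow_near (x := 2 * 3 ^ d * (m : ℝ)) (by linarith) ha1
  have hnn : n₀ ≤ n + 1 :=
    ((pow_lt_pow_iff_right₀ ha1).1 (h4.trans_lt (hmm.trans_lt hn2))).le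
  refine le_quantizationRate_of_le h3 hy h2 (h1 (n + 1) ?_ (hheavy _ hnn) ?_)
  · rw [hpow]; exact hn2.le
  · rw [hpow, pow_succ]
    nlinarith

/-- Below the critical point some level of the coarse multifractal count grows quickly infinitely
often. -/
lemma exists_frequently_le_card_heavyIndices (hd : 0 < d) {r q : ℝ} (hr : 0 < r) (hq : 0 < q)
    (h : q < criticalPoint ν r) :
    ∃ α : ℝ, 0 < α ∧ ∃ᶠ n : ℕ in atTop,
      (2 : ℝ) ^ (α * q * n) ≤ (heavyIndices ν r n (2 ^ (-α * n))).card := by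
  have hq1 : q ≤ 1 := (h.trans (criticalPoint_lt_one hν hr)).le
  obtain ⟨c, hc1, hc2⟩ :=
    EReal.lt_iff_exists_real_btwn.1 (lt_lqSpectrum_of_lt_criticalPoint hν hr hq h)
  rw [EReal.coe_lt_coe_iff] at hc1
  obtain ⟨δ, hδ⟩ : ∃ δ, δ = c - r * q := ⟨_, rfl⟩
  have hδ0 : 0 < δ := by linarith
  -- Weight classes have ratio 2^(ε n), so replacing a weight by the top of its class costs 2^(ε q
  -- n) = 2^(δ n / 2) in the sum.
  obtain ⟨ε, hε⟩ : ∃ ε, ε = δ / (2 * q) := ⟨_, rfl⟩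
  have hε0 : 0 < ε := by rw [hε]; positivity
  have hεq : ε * q = δ / 2 := by rw [hε]; field_simp
  -- After J classes with J ε q ≥ d, the remaining at most C₀ 2^(d n) cubes contribute at most C₀
  -- together.
  obtain ⟨J, hJ⟩ := exists_nat_ge ((d : ℝ) / (ε * q))
  rw [div_le_iff₀ (by positivity)] at hJ
  by_contra! hcon
  have hlev : ∀ᶠ n : ℕ in atTop, ∀ j ∈ Finset.range J,
      ((heavyIndices ν r n (2 ^ (-(ε * (j + 1 : ℕ)) * n))).card : ℝ) <
        2 ^ (ε * (j + 1 : ℕ) * q * n) := by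
    rw [Finset.eventually_all]
    intro j _
    have := hcon (ε * (j + 1 : ℕ)) (by positivity)
    simpa only [not_frequently, not_le] using this
  obtain ⟨C₀, hC₀, hcard⟩ := exists_activeIndices_bound hν
  have hlarge : ∀ᶠ n : ℕ in atTop, (J : ℝ) + C₀ ≤ 2 ^ (δ / 2 * n) :=
    ((tendsto_rpow_atTop_of_base_gt_one 2 (by norm_num)).comp
      (tendsto_natCast_atTop_atTop.const_mul_atTop (by positivity))).eventually_ge_atTop _
  obtain ⟨n, hn1, hn2, hn3, hn4⟩ := ((frequently_lt_partitionSum hν hq1 hc2).and_eventually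
    (hlev.and (hlarge.and (eventually_gt_atTop 0)))).exists
  classical
  -- Class j holds weights between 2^(-ε (j+1) n) and 2^(-ε j n); a weight below the first i classes
  -- is covered by the last term.
  have hpt : ∀ k, ∀ i : ℕ, weight ν r (dyadicCube n k) ^ q ≤
      (∑ j ∈ Finset.range i, if (2 : ℝ) ^ (-(ε * (j + 1 : ℕ)) * n) ≤ weight ν r (dyadicCube n k)
        then (2 : ℝ) ^ (-(ε * j * q) * n) else 0) + 2 ^ (-(ε * i * q) * n) := by
    intro k i
    have hw0 := weight_nonneg ν r (dyadicCube n k)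
    induction i with
    | zero =>
      simp only [Finset.range_zero, Finset.sum_empty, Nat.cast_zero, mul_zero, zero_mul, neg_zero,
        Real.rpow_zero, zero_add]
      refine Real.rpow_le_one hw0 ?_ hq.le
      rw [weight_dyadicCube hd]
      refine mul_le_one₀ measureReal_le_one (by positivity) ?_
      refine Real.rpow_le_one_of_one_le_of_nonpos (by norm_num) ?_
      have : 0 ≤ r * n := by positivity
      linarith
    | succ i ih =>
      rw [Finset.sum_range_succ]
      split_ifs with hwi
      · have : (0 : ℝ) ≤ 2 ^ (-(ε * (i + 1 : ℕ) * q) * n) := by positivity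
        linarith
      · have h1 : weight ν r (dyadicCube n k) ^ q ≤ 2 ^ (-(ε * (i + 1 : ℕ) * q) * n) := by
          calc weight ν r (dyadicCube n k) ^ q
              ≤ ((2 : ℝ) ^ (-(ε * (i + 1 : ℕ)) * n)) ^ q :=
                Real.rpow_le_rpow hw0 (not_le.1 hwi).le hq.le
            _ = _ := by rw [← Real.rpow_mul (by norm_num)]; ring_nf
        have h2 : 0 ≤ ∑ j ∈ Finset.range i,
            if (2 : ℝ) ^ (-(ε * (j + 1 : ℕ)) * n) ≤ weight ν r (dyadicCube n k)
              then (2 : ℝ) ^ (-(ε * j * q) * n) else 0 :=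
          Finset.sum_nonneg fun j _ => by split_ifs <;> positivity
        linarith
  have hsum : ∑ k ∈ activeIndices ν n, weight ν r (dyadicCube n k) ^ q ≤
      (J + C₀) * 2 ^ (δ / 2 * n) := by
    calc _ ≤ ∑ k ∈ activeIndices ν n, ((∑ j ∈ Finset.range J,
            if (2 : ℝ) ^ (-(ε * (j + 1 : ℕ)) * n) ≤ weight ν r (dyadicCube n k)
              then (2 : ℝ) ^ (-(ε * j * q) * n) else 0) + 2 ^ (-(ε * J * q) * n)) :=
          Finset.sum_le_sum fun k _ => hpt k J
      _ = (∑ j ∈ Finset.range J, ((heavyIndices ν r n (2 ^ (-(ε * (j + 1 : ℕ)) * n))).card : ℝ) *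
            2 ^ (-(ε * j * q) * n)) + (activeIndices ν n).card * 2 ^ (-(ε * J * q) * n) := by
          rw [Finset.sum_add_distrib, Finset.sum_comm, Finset.sum_const, nsmul_eq_mul]
          congr 1
          refine Finset.sum_congr rfl fun j _ => ?_
          rw [← Finset.sum_filter, Finset.sum_const, nsmul_eq_mul]
          simp only [heavyIndices]
      _ ≤ (∑ _j ∈ Finset.range J, (2 : ℝ) ^ (δ / 2 * n)) + C₀ * 2 ^ (δ / 2 * n) := by
          refine add_le_add (Finset.sum_le_sum fun j hj => ?_) ?_
          · calc _ ≤ (2 : ℝ) ^ (ε * (j + 1 : ℕ) * q * n) * 2 ^ (-(ε * j * q) * n) := by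
                  gcongr
                  exact (hn2 j hj).le
              _ = (2 : ℝ) ^ (δ / 2 * n) := by
                  rw [← Real.rpow_add (by norm_num), ← hεq]
                  push_cast
                  ring_nf
          · calc _ ≤ C₀ * 2 ^ (n * d) * (2 : ℝ) ^ (-(ε * J * q) * n) := by
                  gcongr
                  exact (hcard n).2
              _ = C₀ * 2 ^ ((d - ε * J * q) * n) := by
                  rw [mul_assoc, ← Real.rpow_natCast, ← Real.rpow_add (by norm_num)]
                  push_cast
                  ring_nf
              _ ≤ C₀ * 2 ^ (δ / 2 * n) := by
                  gcongr
                  · norm_num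
                  · linarith
      _ = _ := by rw [Finset.sum_const, Finset.card_range, nsmul_eq_mul]; ring
  rw [sum_weight_rpow hd] at hsum
  -- The sum exceeds 2^(δ n), yet it is at most (J + C₀) 2^(δ n / 2) ≤ 2^(δ n): the contradiction.
  have hlow : (2 : ℝ) ^ (δ * n) < 2 ^ (-(r * q) * n) * partitionSum ν n q := by
    calc (2 : ℝ) ^ (δ * n) = 2 ^ (-(r * q) * n) * 2 ^ (c * n) := by
          rw [← Real.rpow_add (by norm_num), hδ]; ring_nf
      _ < _ := by gcongr
  have hhigh : ((J : ℝ) + C₀) * 2 ^ (δ / 2 * n) ≤ 2 ^ (δ * n) := by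
    calc _ ≤ (2 : ℝ) ^ (δ / 2 * n) * 2 ^ (δ / 2 * n) := by gcongr
      _ = _ := by rw [← Real.rpow_add (by norm_num)]; ring_nf
  linarith

lemma le_upperQuantizationDim (hd : 0 < d) {r y : ℝ} (hr : 0 < r) (hy : 0 < y)
    (h : y / (y + r) < criticalPoint ν r) : (y : EReal) ≤ upperQuantizationDim ν r := by
  obtain ⟨f, hfy, hfc⟩ := exists_between h
  have hf : 0 < f := lt_trans (by positivity) hfy
  obtain ⟨α, hα, hfreq⟩ := exists_frequently_le_card_heavyIndices hν hd hr hf hfc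
  set a : ℝ := 2 ^ (α * f) with ha
  have ha1 : 1 < a := Real.one_lt_rpow (by norm_num) (by positivity)
  have hpow : ∀ n : ℕ, (2 : ℝ) ^ (α * f * n) = a ^ n := fun n => by
    rw [Real.rpow_mul (by norm_num), Real.rpow_natCast]
  have htend : Tendsto (fun n : ℕ => a ^ n / (2 * 3 ^ d)) atTop atTop :=
    (tendsto_pow_atTop_atTop_of_one_lt ha1).atTop_div_const (by positivity)
  -- The largest m admissible at level n. Once m ≥ 1, rounding loses at most a factor 2, whence K =
  -- 4 · 3^d.
  have hm : Tendsto (fun n : ℕ => ⌊a ^ n / (2 * 3 ^ d)⌋₊) atTop atTop :=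
    tendsto_nat_floor_atTop.comp htend
  refine le_limsup_of_frequently_le (hm.frequently
    (p := fun m => (y : EReal) ≤ quantizationRate ν r m) ?_) (by isBoundedDefault)
  refine (hfreq.and_eventually ((hm.eventually ((eventually_le_quantizationError hν hd
    (K := 4 * 3 ^ d) (α := α) (by positivity) hr hf hy hfy).and
      ((eventually_quantizationError_lt_one hν hd hr).1.and (eventually_ge_atTop 2)))).and
        (htend.eventually_ge_atTop 1))).mono fun n hn => ?_
  obtain ⟨h1, ⟨h2, h3, h4⟩, h5⟩ := hn
  have h3d : (0 : ℝ) < 2 * 3 ^ d := by positivity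
  have hfl := Nat.floor_le (zero_le_one.trans h5)
  have hfl' := Nat.lt_floor_add_one (a ^ n / (2 * 3 ^ d))
  have h4' : (2 : ℝ) ≤ ⌊a ^ n / (2 * 3 ^ d)⌋₊ := by exact_mod_cast h4
  refine le_quantizationRate_of_le h4 hy h3 (h2 n ?_ h1 ?_)
  · rw [hpow]
    rw [le_div_iff₀ h3d] at hfl
    linarith
  · rw [hpow]
    have : a ^ n / (2 * 3 ^ d) ≤ 2 * ⌊a ^ n / (2 * 3 ^ d)⌋₊ := by linarith
    rw [div_le_iff₀ h3d] at this
    linarith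

end Dim

/-! ### From exponents to dimensions, and the chain of inequalities -/

lemma mul_div_one_sub_lt_iff {r f y : ℝ} (hr : 0 < r) (hf : f < 1) (hy : 0 < y) :
    r * f / (1 - f) < y ↔ f < y / (y + r) := by
  rw [div_lt_iff₀ (by linarith), lt_div_iff₀ (by positivity)]
  constructor <;> intro h <;> linarith

lemma lt_mul_div_one_sub_iff {r f y : ℝ} (hr : 0 < r) (hf : f < 1) (hy : 0 < y) :
    y < r * f / (1 - f) ↔ y / (y + r) < f := by
  rw [lt_div_iff₀ (by linarith), div_lt_iff₀ (by positivity)]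
  constructor <;> intro h <;> linarith

section Main

variable {ν : Measure (E d)} [IsProbabilityMeasure ν]
  (hν : ∃ K : Set (E d), IsCompact K ∧ ν Kᶜ = 0)

include hν

/-- Every t in (q_r, 1] satisfies β(t) < r t and so bounds the entropy; let t decrease to q_r. -/
lemma exists_coe_lowerPartitionEntropy (hd : 0 < d) {r : ℝ} (hr : 0 < r) :
    ∃ h : ℝ, lowerPartitionEntropy ν r = h ∧ 0 ≤ h ∧ h ≤ criticalPoint ν r := by
  obtain ⟨s, hs, hs1, hlt⟩ := exists_lqSpectrum_lt hν hr
  obtain ⟨h0, h1⟩ := lowerPartitionEntropy_mem hν hd hr hs hs1.le hlt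
  have hcoe := EReal.coe_toReal (h1.trans_lt (EReal.coe_lt_top s)).ne
    ((EReal.bot_lt_coe 0).trans_le h0).ne'
  refine ⟨_, hcoe.symm, EReal.toReal_nonneg h0, le_of_forall_gt_imp_ge_of_dense fun t ht => ?_⟩
  have ht0 := (criticalPoint_nonneg r).trans_lt ht
  rcases le_or_gt t 1 with ht1 | ht1
  · have := (lowerPartitionEntropy_mem hν hd hr ht0 ht1
      (lqSpectrum_lt_of_criticalPoint_lt hν hr ht ht1)).2
    rwa [← hcoe, EReal.coe_le_coe_iff] at this
  · rw [← hcoe, EReal.coe_le_coe_iff] at h1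
    linarith

lemma exists_coe_lowerCoarseDim (hd : 0 < d) {r : ℝ} (hr : 0 < r) :
    ∃ F : ℝ, lowerCoarseDim ν r = F ∧ 0 ≤ F ∧ F < 1 := by
  obtain ⟨s, hs, hs1, hlt⟩ := exists_lqSpectrum_lt hν hr
  obtain ⟨h0, h1⟩ := lowerCoarseDim_mem hν hd hs hs1.le hlt
  have hcoe := EReal.coe_toReal (h1.trans_lt (EReal.coe_lt_top s)).ne
    ((EReal.bot_lt_coe 0).trans_le h0).ne'
  refine ⟨_, hcoe.symm, EReal.toReal_nonneg h0, ?_⟩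
  rw [← hcoe, EReal.coe_le_coe_iff] at h1
  linarith

lemma mul_lowerCoarseDim_div_le (hd : 0 < d) {r F : ℝ} (hr : 0 < r)
    (hF : lowerCoarseDim ν r = F) (hF1 : F < 1) :
    ((r * F / (1 - F) : ℝ) : EReal) ≤ lowerQuantizationDim ν r := by
  by_contra hcon
  obtain ⟨y, hy1, hy2⟩ := EReal.lt_iff_exists_real_btwn.1 (not_le.1 hcon)
  -- The lower dimension is nonnegative, so any y above it is positive.
  have hy : 0 < y :=
    EReal.coe_pos.1 ((eventually_quantizationError_lt_one hν hd hr).2.trans_lt hy1)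
  rw [EReal.coe_lt_coe_iff, lt_mul_div_one_sub_iff hr hF1 hy, ← EReal.coe_lt_coe_iff, ← hF] at hy2
  exact absurd hy1 (not_lt.2 (le_lowerQuantizationDim hν hd hr hy hy2))

lemma lowerQuantizationDim_le (hd : 0 < d) {r h : ℝ} (hr : 0 < r)
    (hh : lowerPartitionEntropy ν r = h) (h0 : 0 ≤ h) (h1 : h < 1) :
    lowerQuantizationDim ν r ≤ ((r * h / (1 - h) : ℝ) : EReal) := by
  by_contra hcon
  obtain ⟨y, hy1, hy2⟩ := EReal.lt_iff_exists_real_btwn.1 (not_le.1 hcon)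
  rw [EReal.coe_lt_coe_iff] at hy1
  have hG : 0 ≤ r * h / (1 - h) := div_nonneg (by positivity) (by linarith)
  have hy : 0 < y := hG.trans_lt hy1
  rw [mul_div_one_sub_lt_iff hr h1 hy] at hy1
  obtain ⟨s, hs1, hs2⟩ := exists_between hy1
  rw [← EReal.coe_lt_coe_iff, ← hh] at hs1
  refine absurd hy2 (not_lt.2 ?_)
  refine lowerQuantizationDim_le_of_lowerPartitionEntropy_lt hν hd hr ?_ hs1 hy hs2
  rw [hh, EReal.coe_lt_coe_iff] at hs1
  linarith

lemma le_upperQuantizationDim_criticalPoint (hd : 0 < d) {r : ℝ} (hr : 0 < r) :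
    ((r * criticalPoint ν r / (1 - criticalPoint ν r) : ℝ) : EReal) ≤
      upperQuantizationDim ν r := by
  by_contra hcon
  obtain ⟨y, hy1, hy2⟩ := EReal.lt_iff_exists_real_btwn.1 (not_le.1 hcon)
  have hle : lowerQuantizationDim ν r ≤ upperQuantizationDim ν r := liminf_le_limsup
  have hy : 0 < y :=
    EReal.coe_pos.1 (((eventually_quantizationError_lt_one hν hd hr).2.trans hle).trans_lt hy1)
  rw [EReal.coe_lt_coe_iff, lt_mul_div_one_sub_iff hr (criticalPoint_lt_one hν hr) hy] at hy2
  exact absurd hy1 (not_lt.2 (le_upperQuantizationDim hν hd hr hy hy2))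

lemma upperQuantizationDim_le_criticalPoint (hd : 0 < d) {r : ℝ} (hr : 0 < r) :
    upperQuantizationDim ν r ≤
      ((r * criticalPoint ν r / (1 - criticalPoint ν r) : ℝ) : EReal) := by
  by_contra hcon
  have h0 := criticalPoint_nonneg (ν := ν) r
  have h1 := criticalPoint_lt_one hν hr
  obtain ⟨y, hy1, hy2⟩ := EReal.lt_iff_exists_real_btwn.1 (not_le.1 hcon)
  rw [EReal.coe_lt_coe_iff] at hy1
  have hG : 0 ≤ r * criticalPoint ν r / (1 - criticalPoint ν r) :=
    div_nonneg (by positivity) (by linarith)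
  have hy : 0 < y := hG.trans_lt hy1
  rw [mul_div_one_sub_lt_iff hr h1 hy] at hy1
  obtain ⟨s, hs1, hs2⟩ := exists_between hy1
  have hlt : y / (y + r) < 1 := by rw [div_lt_one (by positivity)]; linarith
  have hs := lqSpectrum_lt_of_criticalPoint_lt hν hr hs1 (hs2.trans hlt).le
  exact absurd hy2 (not_lt.2 (quantizationDim_mem_of_eventually hy
    (eventually_quantizationError_le hν hd hr (h0.trans_lt hs1) hs hy hs2)).2)

/-- Every s > 0 satisfies 0 = β(s) < r s, so y may be taken arbitrarily small. -/
lemma quantizationDim_eq_zero (hd : 0 < d) (h : ∀ x : ℝ, 0 < x → lqSpectrum ν x = 0) {r : ℝ}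
    (hr : 0 ≤ r) : lowerQuantizationDim ν r = 0 ∧ upperQuantizationDim ν r = 0 := by
  have key : ∀ y : ℝ, 0 < y → 0 ≤ lowerQuantizationDim ν r ∧ upperQuantizationDim ν r ≤ y := by
    intro y hy
    refine quantizationDim_mem_of_eventually hy ?_
    rcases hr.eq_or_lt with rfl | hr
    · obtain ⟨s, hs, hsy⟩ := exists_between (show 0 < y / (y + 1) by positivity)
      exact eventually_quantizationError_zero_le hν hd hs
        (by rw [h s hs]; exact EReal.coe_pos.2 hs) hy hsy
    · obtain ⟨s, hs, hsy⟩ := exists_between (show 0 < y / (y + r) by positivity)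
      exact eventually_quantizationError_le hν hd hr hs
        (by rw [h s hs]; exact EReal.coe_pos.2 (mul_pos hr hs)) hy hsy
  have hlow := (key 1 one_pos).1
  have hle : lowerQuantizationDim ν r ≤ upperQuantizationDim ν r := liminf_le_limsup
  have hup : upperQuantizationDim ν r ≤ 0 := by
    by_contra hcon
    obtain ⟨y, hy1, hy2⟩ := EReal.lt_iff_exists_real_btwn.1 (not_le.1 hcon)
    exact absurd hy2 (not_lt.2 (key y (EReal.coe_pos.1 hy1)).2)
  exact ⟨le_antisymm (hle.trans hup) hlow, le_antisymm hup (hlow.trans hle)⟩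

end Main

end Quantization

theorem theorem1p1 (d : ℕ) (hd : 0 < d) (ν : Measure (EuclideanSpace ℝ (Fin d)))
    [IsProbabilityMeasure ν] (hν : ∃ K : Set (EuclideanSpace ℝ (Fin d)), IsCompact K ∧ ν Kᶜ = 0) :
    ((0 < ⨆ x ∈ Set.Ioo (0 : ℝ) 1, Quantization.lqSpectrum ν x) →
      ∀ r : ℝ, 0 < r →
        Quantization.lowerCoarseDim ν r < 1 ∧
        Quantization.lowerPartitionEntropy ν r < 1 ∧
        Quantization.criticalPoint ν r < 1 ∧
        (r : EReal) * Quantization.lowerCoarseDim ν r / (1 - Quantization.lowerCoarseDim ν r)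
          ≤ Quantization.lowerQuantizationDim ν r ∧
        Quantization.lowerQuantizationDim ν r
          ≤ (r : EReal) * Quantization.lowerPartitionEntropy ν r
              / (1 - Quantization.lowerPartitionEntropy ν r) ∧
        (r : EReal) * Quantization.lowerPartitionEntropy ν r
              / (1 - Quantization.lowerPartitionEntropy ν r)
          ≤ Quantization.upperQuantizationDim ν r ∧
        Quantization.upperQuantizationDim ν r
          = Quantization.renyiDim ν (Quantization.criticalPoint ν r) ∧
        Quantization.renyiDim ν (Quantization.criticalPoint ν r)
          = ((r * Quantization.criticalPoint ν r / (1 - Quantization.criticalPoint ν r) : ℝ) :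
              EReal)) ∧
    ((∀ x : ℝ, 0 < x → Quantization.lqSpectrum ν x = 0) →
      ∀ r : ℝ, 0 ≤ r →
        Quantization.lowerQuantizationDim ν r = 0 ∧
        Quantization.upperQuantizationDim ν r = 0) := by
  refine ⟨fun hpos r hr => ?_, fun h r hr => Quantization.quantizationDim_eq_zero hν hd h hr⟩
  have hc0 := Quantization.criticalPoint_pos hν hpos hr
  have hc1 := Quantization.criticalPoint_lt_one hν hr
  obtain ⟨F, hF, hF0, hF1⟩ := Quantization.exists_coe_lowerCoarseDim hν hd hr
  obtain ⟨h, hh, hh0, hhc⟩ := Quantization.exists_coe_lowerPartitionEntropy hν hd hr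
  have hh1 := hhc.trans_lt hc1
  have hcoe : ∀ t : ℝ, (r : EReal) * t / (1 - t) = ((r * t / (1 - t) : ℝ) : EReal) := fun t => by
    rw [EReal.coe_div, EReal.coe_mul, EReal.coe_sub, EReal.coe_one]
  have hlow := Quantization.le_upperQuantizationDim_criticalPoint hν hd hr
  have hup := Quantization.upperQuantizationDim_le_criticalPoint hν hd hr
  have hrenyi := Quantization.renyiDim_criticalPoint hν hr hc0
  have hFD := Quantization.mul_lowerCoarseDim_div_le hν hd hr hF hF1
  have hDh := Quantization.lowerQuantizationDim_le hν hd hr hh hh0 hh1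
  -- Monotonicity of t ↦ r t / (1 - t) together with h ≤ q_r.
  have hmono : ((r * h / (1 - h) : ℝ) : EReal) ≤ Quantization.upperQuantizationDim ν r := by
    refine le_trans (EReal.coe_le_coe_iff.2 ?_) hlow
    exact div_le_div₀ (by positivity) (by gcongr) (by linarith) (by linarith)
  rw [hF, hh, hcoe, hcoe]
  exact ⟨by exact_mod_cast hF1, by exact_mod_cast hh1, hc1, hFD, hDh, hmono,
    (le_antisymm hup hlow).trans hrenyi.symm, hrenyi⟩
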